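/- **Theorem 4.1.** Let $H$ be a separable real Hilbert space, $U$ a real Hilbert space, $T>0$ and $X_0\in H$. Assume: (i) $A:D(A)\subseteq H\to H$ is a closed, densely defined linear operator generating a $C_0$-semigroup $S(t)$, $t\ge 0$, on $H$, and there is $\lambda>0$ with $\|S(t)\|\le e^{\lambda t}$ for all $t\ge 0$; (ii) $f:H\to H$ is demicontinuous: $x_n\to x$ strongly in $H$ implies $f(x_n)\to f(x)$ weakly in $H$; (iii) there are $C\in\mathbb R$ and $m\in\mathbb N$ with $\|f(x)\|\le C(1+\|x\|^m)$ for all $x\in H$; (iv) there is $M\ge 0$ with $\langle f(x)-f(y),x-y\rangle\le M\|x-y\|^2$ for all $x,y\in H$; (v) $g$ maps $H$ into the space $L_2(U,H)$ of Hilbert–Schmidt operators, with norm $\|\cdot\|_2$, and there is $D\ge 0$ with $\|g(x)-g(y)\|_2\le D\|x-y\|$ for all $x,y\in H$. Then for every $u\in L^2([0,T];U)$ the skeleton equation $$z_t=S(t)X_0+\int_0^t S(t-s)\bigl(f(z_s)+g(z_s)u_s\bigr)\,ds,\qquad t\in[0,T],$$ has a unique solution $z\in C([0,T];H)$; denote it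 by $\mathcal G^0\bigl(\int_0^\cdot u_s\,ds\bigr)$. Equip $C([0,T];H)$ with the sup-norm, and for $N\in\mathbb R$ put $$\mathcal S_N=\Bigl\{u\in L^2([0,T];U):\int_0^T\|u_s\|_U^2\,ds\le N\Bigr\},\qquad K_N=\Bigl\{\mathcal G^0\Bigl(\int_0^\cdot u_s\,ds\Bigr):u\in\mathcal S_N\Bigr\}.$$ Then: (a) for every $N<\infty$ the set $K_N$ is compact in $C([0,T];H)$; (b) the rate function $$I(\varphi)=\inf\Bigl\{\tfrac12\int_0^T\|u_s\|_U^2\,ds:\ u\in L^2([0,T];U),\ \varphi=\mathcal G^0\Bigl(\int_0^\cdot u_s\,ds\Bigr)\Bigr\}\in[0,\infty],\qquad \inf\emptyset=\infty,$$ on $C([0,T];H)$ is good: it is lower semicontinuous and $\{\varphi: I(\varphi)\le N\}$ is compact for every $0\le N<\infty$; (c) if $u^n,u^0\in\mathcal S_N$ and $u^n\to u^0$ weakly in $L^2([0,T];U)$, then $\mathcal G^0\bigl(\int_0^\cdot u^n_s\,ds\bigr)\to\mathcal G^0\bigl(\int_0^\cdot u^0_s\,ds\bigr)$ uniformly on $[0,T]$.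 -/

import Mathlib

open MeasureTheory Filter Topology Set
open scoped ENNReal NNReal

noncomputable section

/-! ### Hilbert-Schmidt operators -/

section HilbertSchmidt

variable {U H : Type*} [NormedAddCommGroup U] [InnerProductSpace ℝ U] [CompleteSpace U]
  [NormedAddCommGroup H] [InnerProductSpace ℝ H]

/-- The index set of a fixed orthonormal basis of the Hilbert space `U`. -/
def onbIndex (U : Type*) [NormedAddCommGroup U] [InnerProductSpace ℝ U] [CompleteSpace U] :
    Set U :=
  (exists_hilbertBasis ℝ U).choose

/-- A fixed orthonormal (Hilbert) basis of the Hilbert space `U`. -/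
def onb (U : Type*) [NormedAddCommGroup U] [InnerProductSpace ℝ U] [CompleteSpace U] :
    HilbertBasis (onbIndex U) ℝ U :=
  (exists_hilbertBasis ℝ U).choose_spec.choose

/-- The Hilbert-Schmidt norm `‖B‖₂ = (∑ₑ ‖B e‖²)^(1/2)` in `[0, ∞]`, where `e` runs through an
orthonormal basis of `U`. It does not depend on the basis, see `hsNorm_eq`. -/
def hsNorm (B : U →L[ℝ] H) : ℝ≥0∞ :=
  (∑' i, ‖B (onb U i)‖ₑ ^ 2) ^ (1 / 2 : ℝ)

/-- `B` is a Hilbert-Schmidt operator: a bounded operator with finite Hilbert-Schmidt norm. -/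
def IsHilbertSchmidt (B : U →L[ℝ] H) : Prop :=
  hsNorm B < ∞

lemma tsum_enorm_inner_sq {ι : Type*} (b : HilbertBasis ι ℝ U) (x : U) :
    ∑' i, ‖inner ℝ (b i) x‖ₑ ^ 2 = ‖x‖ₑ ^ 2 := by
  have h := b.hasSum_inner_mul_inner x x
  have h2 : HasSum (fun i => ‖inner ℝ (b i) x‖ ^ 2) (‖x‖ ^ 2) := by
    rw [← real_inner_self_eq_norm_sq]
    refine h.congr_fun ?_
    intro i
    rw [real_inner_comm (b i) x, Real.norm_eq_abs, sq_abs, sq]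
  have h3 := ENNReal.ofReal_tsum_of_nonneg (fun i => sq_nonneg ‖inner ℝ (b i) x‖) h2.summable
  rw [h2.tsum_eq] at h3
  simp_rw [ENNReal.ofReal_pow (norm_nonneg _), ofReal_norm] at h3
  exact h3.symm

lemma tsum_enorm_apply_sq [CompleteSpace H] {ι : Type*} (b : HilbertBasis ι ℝ U)
    (B : U →L[ℝ] H) : ∑' i, ‖B (b i)‖ₑ ^ 2 =
      ∑' j, ‖ContinuousLinearMap.adjoint B (onb H j)‖ₑ ^ 2 := by
  simp_rw [← tsum_enorm_inner_sq (onb H) (B _), ← tsum_enorm_inner_sq b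
    (ContinuousLinearMap.adjoint B _)]
  rw [ENNReal.tsum_comm]
  refine tsum_congr fun j => tsum_congr fun i => ?_
  rw [ContinuousLinearMap.adjoint_inner_right, real_inner_comm]

/-- The Hilbert-Schmidt norm may be computed in any orthonormal basis. -/
lemma hsNorm_eq [CompleteSpace H] {ι : Type*} (b : HilbertBasis ι ℝ U) (B : U →L[ℝ] H) :
    hsNorm B = (∑' i, ‖B (b i)‖ₑ ^ 2) ^ (1 / 2 : ℝ) := by
  rw [hsNorm, tsum_enorm_apply_sq (onb U), tsum_enorm_apply_sq b]

end HilbertSchmidt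

/-! ### Strongly continuous semigroups and their generators -/

section Semigroup

variable {H : Type*} [NormedAddCommGroup H] [InnerProductSpace ℝ H]

/-- `S(t)`, `t ≥ 0`, is a `C₀`-semigroup of bounded operators on `H`
(the values `S t` at `t < 0` play no role). -/
structure IsC0Semigroup (S : ℝ → H →L[ℝ] H) : Prop where
  zero : S 0 = ContinuousLinearMap.id ℝ H
  add : ∀ s t : ℝ, 0 ≤ s → 0 ≤ t → S (s + t) = (S s).comp (S t)
  tendsto_zero : ∀ x : H, Tendsto (fun t => S t x) (𝓝[>] 0) (𝓝 x)

/-- The (unbounded) operator `A : D(A) ⊆ H → H` is the infinitesimal generator of `S`: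
`x ∈ D(A)` and `A x = y` if and only if `(S(h) x - x) / h → y` as `h ↓ 0`. -/
def IsGeneratorOf (A : H →ₗ.[ℝ] H) (S : ℝ → H →L[ℝ] H) : Prop :=
  ∀ x y : H, (x, y) ∈ A.graph ↔
    Tendsto (fun h : ℝ => h⁻¹ • (S h x - x)) (𝓝[>] 0) (𝓝 y)

/-- `f` is demicontinuous: `xₙ → x` strongly implies `f(xₙ) → f(x)` weakly. -/
def Demicontinuous (f : H → H) : Prop :=
  ∀ (x : ℕ → H) (x₀ : H), Tendsto x atTop (𝓝 x₀) →
    ∀ v : H, Tendsto (fun n => inner ℝ (f (x n)) v) atTop (𝓝 (inner ℝ (f x₀) v))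

end Semigroup

/-! ### Controls, the skeleton equation, and the rate function -/

section Skeleton

variable {U H : Type*} [NormedAddCommGroup U] [InnerProductSpace ℝ U]
  [NormedAddCommGroup H] [InnerProductSpace ℝ H]

/-- The space of controls `L²([0, T]; U)`. -/
abbrev ControlSpace (T : ℝ) (U : Type*) [NormedAddCommGroup U] : Type _ :=
  Lp U 2 (volume.restrict (Icc (0 : ℝ) T))

/-- `𝒮_N = {u ∈ L²([0, T]; U) : ∫₀ᵀ ‖u(s)‖² ds ≤ N}`. -/
def controlBall (T : ℝ) (U : Type*) [NormedAddCommGroup U] (N : ℝ) : Set (ControlSpace T U) :=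
  {u | ∫ s in (0 : ℝ)..T, ‖u s‖ ^ 2 ≤ N}

lemma continuous_primitive_control {T : ℝ} (u : ControlSpace T U) :
    Continuous fun t : Icc (0 : ℝ) T => ∫ s in (0 : ℝ)..t, u s := by
  have hu : IntegrableOn u (Icc 0 T) volume := (Lp.memLp u).integrable (by norm_num)
  rcases le_or_gt 0 T with hT | hT
  · have h := intervalIntegral.continuousOn_primitive_interval (a := 0) (b := T) (f := u)
      (μ := volume) (by rwa [uIcc_of_le hT])
    rw [uIcc_of_le hT] at h
    exact continuousOn_iff_continuous_domRestrict.mp h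
  · exact continuous_of_const fun x => absurd (x.2.1.trans x.2.2) (not_le.mpr hT)

/-- The path `t ↦ ∫₀ᵗ u(s) ds` in `C([0, T]; U)`. -/
def controlPrimitive {T : ℝ} (u : ControlSpace T U) : C(Icc (0 : ℝ) T, U) where
  toFun t := ∫ s in (0 : ℝ)..t, u s
  continuous_toFun := continuous_primitive_control u

/-- `z ∈ C([0, T]; H)` is a (mild) solution of the skeleton equation with control `u`: for all
`t ∈ [0, T]`, `z(t) = S(t) X₀ + ∫₀ᵗ S(t - s) (f(z(s)) + g(z(s)) u(s)) ds`, the integral being a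
convergent Bochner integral. (`IccExtend hT z s` is `z s` for `s ∈ [0, T]`.) -/
def IsSkeletonSolution {T : ℝ} (hT : 0 ≤ T) (S : ℝ → H →L[ℝ] H) (f : H → H)
    (g : H → U →L[ℝ] H) (X₀ : H) (u : ControlSpace T U) (z : C(Icc (0 : ℝ) T, H)) : Prop :=
  ∀ t : Icc (0 : ℝ) T,
    IntervalIntegrable
      (fun s => S (t - s) (f (IccExtend hT z s) + g (IccExtend hT z s) (u s))) volume 0 t ∧
    z t = S t X₀ +
      ∫ s in (0 : ℝ)..t, S (t - s) (f (IccExtend hT z s) + g (IccExtend hT z s) (u s))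

open Classical in
/-- The map `𝒢⁰ : C([0, T]; U) → C([0, T]; H)`. It sends `∫₀ u(s) ds`, for `u ∈ L²([0, T]; U)`,
to the solution of the skeleton equation with control `u`, and every other path to `0`. -/
def skeletonMap {T : ℝ} (hT : 0 ≤ T) (S : ℝ → H →L[ℝ] H) (f : H → H)
    (g : H → U →L[ℝ] H) (X₀ : H) (w : C(Icc (0 : ℝ) T, U)) : C(Icc (0 : ℝ) T, H) :=
  if h : ∃ z : C(Icc (0 : ℝ) T, H), ∃ u : ControlSpace T U,
      controlPrimitive u = w ∧ IsSkeletonSolution hT S f g X₀ u z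
  then h.choose else 0

/-- `K_N = {𝒢⁰(∫₀ u(s) ds) : u ∈ 𝒮_N}`. -/
def skeletonSet {T : ℝ} (hT : 0 ≤ T) (S : ℝ → H →L[ℝ] H) (f : H → H)
    (g : H → U →L[ℝ] H) (X₀ : H) (N : ℝ) : Set C(Icc (0 : ℝ) T, H) :=
  {z | ∃ u ∈ controlBall T U N, z = skeletonMap hT S f g X₀ (controlPrimitive u)}

/-- The rate function
`I(φ) = inf {½ ∫₀ᵀ ‖u(s)‖² ds : u ∈ L²([0, T]; U), φ = 𝒢⁰(∫₀ u(s) ds)} ∈ [0, ∞]`, `inf ∅ = ∞`. -/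
def rateFunction {T : ℝ} (hT : 0 ≤ T) (S : ℝ → H →L[ℝ] H) (f : H → H)
    (g : H → U →L[ℝ] H) (X₀ : H) (φ : C(Icc (0 : ℝ) T, H)) : ℝ≥0∞ :=
  ⨅ (u : ControlSpace T U) (_ : φ = skeletonMap hT S f g X₀ (controlPrimitive u)),
    ENNReal.ofReal (1 / 2 * ∫ s in (0 : ℝ)..T, ‖u s‖ ^ 2)

end Skeleton

end

/-! ### Two integral inequalities on an interval -/

section IntegralInequalities

/-! Everything rests on one energy estimate. If `z` is a mild solution with forcing `F`, then `z b =
q + r` with `q = S (b - a) (z a)` and `r` the forcing integral over `[a, b]`. Here `‖q + r‖² ≤ ‖q‖²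
+ 2⟨z b, r⟩` and `‖q‖² ≤ exp (2λ(b - a)) ‖z a‖²`. Summing over partitions of vanishing mesh gives
the energy inequality for `exp (-2λt) ‖z t‖²` (`exp_mul_norm_mild_sq_le`) without regularising the
generator. Gronwall turns it into `norm_mild_sq_le`: if `⟨F, p⟩ ≤ k (‖p‖² + b)` along a path `p`
within `ε` of `z`, then `z` is controlled by its initial value, `b` and `ε`.

This estimate serves four times. Existence: with the argument of the nonlinearity delayed by `δ`,
the equation is solved interval by interval; the estimate bounds these approximations and makes them
Cauchy, and demicontinuity identifies the limit. Uniqueness: take `ε = b = 0`. A priori bound: it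
depends on the control only through its `L²` norm. Weak continuity: if `uⁿ → u⁰` weakly, subtract
from `zⁿ - z⁰` the convolution `hⁿ(t) = ∫₀ᵗ S(t - s) g(z⁰(s)) (uⁿ - u⁰)(s) ds`. The rest is the mild
solution driven by the difference of the nonlinearities at `zⁿ` and `z⁰` with the same control `uⁿ`,
and `p = zⁿ - z⁰` differs from it by `hⁿ`. Because `g(z⁰(s))` is Hilbert–Schmidt, the kernel is norm
continuous and completely continuous, so `hⁿ → 0` uniformly.

The rest is topology: `𝒮_N` is weakly compact by Banach–Alaoglu, `K_N` is its image under a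
continuous map, and the sublevel sets of the rate function are intersections of sets `K_N`. -/

lemma abs_exp_neg_sub_exp_neg_le {x y : ℝ} (hx : 0 ≤ x) (hy : 0 ≤ y) :
    |Real.exp (-x) - Real.exp (-y)| ≤ |x - y| := by
  wlog h : x ≤ y generalizing x y
  · rw [abs_sub_comm, abs_sub_comm x y]
    exact this hy hx (le_of_not_ge h)
  have h1 : Real.exp (-y) ≤ Real.exp (-x) := Real.exp_le_exp.2 (by linarith)
  have h2 : Real.exp (-x) ≤ 1 := by simpa using hx
  have h3 : Real.exp (-y) = Real.exp (-x) * Real.exp (x - y) := by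
    rw [← Real.exp_add]; congr 1; ring
  have h4 := Real.add_one_le_exp (x - y)
  rw [abs_of_nonneg (by linarith), abs_of_nonpos (by linarith), h3]
  nlinarith [Real.exp_pos (-x)]

/-- Composition with a 1-Lipschitz function preserves absolute continuity, and `exp (-·)` is
1-Lipschitz on `[0, ∞)`. -/
lemma AbsolutelyContinuousOnInterval.exp_neg {K : ℝ → ℝ} {a b : ℝ}
    (hK : AbsolutelyContinuousOnInterval K a b) (h0 : ∀ t ∈ uIcc a b, 0 ≤ K t) :
    AbsolutelyContinuousOnInterval (fun t => Real.exp (-K t)) a b := by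
  unfold AbsolutelyContinuousOnInterval at hK ⊢
  refine tendsto_of_tendsto_of_tendsto_of_le_of_le' tendsto_const_nhds hK
    (Eventually.of_forall fun E => Finset.sum_nonneg fun _ _ => dist_nonneg) ?_
  refine Filter.Eventually.filter_mono inf_le_right ?_
  rw [eventually_principal]
  intro E hE
  refine Finset.sum_le_sum fun i hi => ?_
  exact abs_exp_neg_sub_exp_neg_le (h0 _ (hE.1 i hi).1) (h0 _ (hE.1 i hi).2)

/-- Gronwall's inequality in integral form with an integrable kernel. -/
lemma le_mul_exp_of_le_add_integral {φ k : ℝ → ℝ} {a τ : ℝ} (hτ : 0 ≤ τ)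
    (hk : IntervalIntegrable k volume 0 τ) (hk0 : ∀ s, 0 ≤ k s) (hφ : Continuous φ)
    (h : ∀ t ∈ Icc 0 τ, φ t ≤ a + ∫ s in (0 : ℝ)..t, k s * φ s) :
    φ τ ≤ a * Real.exp (∫ s in (0 : ℝ)..τ, k s) := by
  set K : ℝ → ℝ := fun t => ∫ s in (0 : ℝ)..t, k s
  set P : ℝ → ℝ := fun t => a + ∫ s in (0 : ℝ)..t, k s * φ s
  set E : ℝ → ℝ := fun t => Real.exp (-K t)
  have hkφ : IntervalIntegrable (fun s => k s * φ s) volume 0 τ :=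
    hk.mul_continuousOn hφ.continuousOn
  have hKac : AbsolutelyContinuousOnInterval K 0 τ :=
    hk.absolutelyContinuousOnInterval_intervalIntegral (by simp)
  have hPac : AbsolutelyContinuousOnInterval P 0 τ := by
    refine AbsolutelyContinuousOnInterval.add ?_
      (hkφ.absolutelyContinuousOnInterval_intervalIntegral (by simp))
    exact (LipschitzWith.const a).lipschitzOnWith.absolutelyContinuousOnInterval (K := 0)
  have hEac : AbsolutelyContinuousOnInterval E 0 τ := by
    refine hKac.exp_neg fun t ht => ?_
    rw [uIcc_of_le hτ] at ht
    exact intervalIntegral.integral_nonneg ht.1 fun s _ => hk0 s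
  have hPE := (hPac.fun_mul hEac).integral_deriv_eq_sub
  -- The kernel is only integrable, so `P * E` is differentiable merely almost everywhere; absolute
  -- continuity is what lets the sign of its derivative bound its increment.
  have hle : ∫ x in (0 : ℝ)..τ, deriv (fun x => P x * E x) x ≤ 0 := by
    rw [intervalIntegral.integral_of_le hτ]
    refine integral_nonpos_of_ae ?_
    filter_upwards [ae_restrict_mem measurableSet_Ioc,
      ae_restrict_of_ae (hk.ae_hasDerivAt_integral),
      ae_restrict_of_ae (hkφ.ae_hasDerivAt_integral)] with x hx h1 h2
    have hx' : x ∈ uIcc 0 τ := by rw [uIcc_of_le hτ]; exact Ioc_subset_Icc_self hx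
    have h1' : HasDerivAt E (Real.exp (-K x) * (-k x)) x := (h1 hx' 0 (by simp)).neg.exp
    have h2' : HasDerivAt P (k x * φ x) x := (h2 hx' 0 (by simp)).const_add a
    rw [show deriv (fun x => P x * E x) x = _ from (h2'.mul h1').deriv]
    have h3 : φ x ≤ P x := h x (Ioc_subset_Icc_self hx)
    have h4 : 0 ≤ k x * E x * (P x - φ x) :=
      mul_nonneg (mul_nonneg (hk0 x) (Real.exp_pos _).le) (by linarith)
    simp only [Pi.zero_apply]
    have : k x * φ x * E x + P x * (Real.exp (-K x) * -k x) = -(k x * E x * (P x - φ x)) := by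
      simp only [E]; ring
    rw [this]; linarith
  rw [hPE] at hle
  have h0 : P 0 * E 0 = a := by simp [P, E, K]
  rw [h0] at hle
  have h5 : φ τ ≤ P τ := h τ ⟨hτ, le_rfl⟩
  have h6 : E τ * Real.exp (K τ) = 1 := by simp [E, ← Real.exp_add]
  calc φ τ ≤ P τ * (E τ * Real.exp (K τ)) := by rw [h6, mul_one]; exact h5
    _ = P τ * E τ * Real.exp (K τ) := by ring
    _ ≤ a * Real.exp (K τ) := by gcongr; linarith

/-- If the increments of `φ` are bounded by integrals of `q b ·` on `[a, b]`, then, passing to the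
limit along partitions, the increment of `φ` is bounded by the integral of the diagonal of `q`. -/
lemma sub_le_integral_diag {φ B : ℝ → ℝ} {q : ℝ → ℝ → ℝ} {t : ℝ} (ht : 0 ≤ t)
    (hφ : ∀ a b, 0 ≤ a → a ≤ b → b ≤ t → φ b - φ a ≤ ∫ s in a..b, q b s)
    (hmeas : ∀ r : ℝ → ℝ, Measurable r →
      AEStronglyMeasurable (fun s => q (r s) s) (volume.restrict (Ioc 0 t)))
    (hB : IntervalIntegrable B volume 0 t)
    (hqB : ∀ s ∈ Ioc 0 t, ∀ r ∈ Icc s t, ‖q r s‖ ≤ B s)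
    (hq : ∀ s ∈ Ioc 0 t, ContinuousAt (fun r => q r s) s) :
    φ t - φ 0 ≤ ∫ s in (0 : ℝ)..t, q s s := by
  rcases ht.eq_or_lt with rfl | ht
  · simp
  -- `r n s` is the right endpoint of the grid cell of length `t / (n + 1)` containing `s`. The
  -- ceiling makes the cells half-open on the left, matching `Ioc`.
  set r : ℕ → ℝ → ℝ := fun n s => t / (n + 1) * ⌈s / (t / (n + 1))⌉
  have hd : ∀ n : ℕ, 0 < t / (n + 1 : ℝ) := fun n => by positivity
  have hr1 : ∀ n s, s ≤ r n s := fun n s => by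
    have := Int.le_ceil (s / (t / (n + 1 : ℝ)))
    rw [div_le_iff₀ (hd n)] at this
    simp only [r]; linarith
  have hr2 : ∀ n s, r n s ≤ s + t / (n + 1) := fun n s => by
    have := (Int.ceil_lt_add_one (s / (t / (n + 1 : ℝ)))).le
    have h2 := mul_le_mul_of_nonneg_left this (hd n).le
    rw [mul_add, mul_div_cancel₀ _ (hd n).ne', mul_one] at h2
    exact h2
  have hr3 : ∀ n : ℕ, ∀ s ≤ t, r n s ≤ t := fun n s hs => by
    have : ⌈s / (t / (n + 1 : ℝ))⌉ ≤ (n + 1 : ℤ) := by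
      rw [Int.ceil_le, div_le_iff₀ (hd n)]
      push_cast
      rwa [mul_div_cancel₀ _ (by positivity)]
    have h2 : (⌈s / (t / (n + 1 : ℝ))⌉ : ℝ) ≤ (n + 1 : ℝ) := by exact_mod_cast this
    calc r n s ≤ t / (n + 1) * (n + 1) := mul_le_mul_of_nonneg_left h2 (hd n).le
      _ = t := div_mul_cancel₀ _ (by positivity)
  have hrm : ∀ n, Measurable (r n) := fun n => by
    refine Measurable.const_mul ?_ _
    exact (measurable_from_top (f := fun z : ℤ => (z : ℝ))).comp
      (Int.measurable_ceil.comp (measurable_id.div_const _))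
  have hlim : Tendsto (fun n => ∫ s in (0 : ℝ)..t, q (r n s) s) atTop
      (𝓝 (∫ s in (0 : ℝ)..t, q s s)) := by
    refine intervalIntegral.tendsto_integral_filter_of_dominated_convergence B ?_ ?_ hB ?_
    · rw [uIoc_of_le ht.le]
      exact Eventually.of_forall fun n => hmeas _ (hrm n)
    · rw [uIoc_of_le ht.le]
      exact Eventually.of_forall fun n => ae_of_all _ fun s hs =>
        hqB s hs _ ⟨hr1 n s, hr3 n s hs.2⟩
    · rw [uIoc_of_le ht.le]
      refine ae_of_all _ fun s hs => (hq s hs).tendsto.comp ?_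
      refine tendsto_of_tendsto_of_tendsto_of_le_of_le tendsto_const_nhds ?_
        (fun n => hr1 n s) (fun n => hr2 n s)
      have : Tendsto (fun n : ℕ => s + t * (1 / ((n : ℝ) + 1))) atTop (𝓝 (s + t * 0)) :=
        tendsto_const_nhds.add (tendsto_one_div_add_atTop_nhds_zero_nat.const_mul t)
      simpa [div_eq_mul_inv] using this
  -- For fixed `n` the increments telescope over the grid, and on each cell `r n s` is constant.
  refine ge_of_tendsto' hlim fun n => ?_
  set p : ℕ → ℝ := fun i => i * (t / (n + 1))
  have hp0 : p 0 = 0 := by simp [p]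
  have hpn : p (n + 1) = t := by
    simp only [p]; push_cast; exact mul_div_cancel₀ _ (by positivity)
  have hpm : ∀ i, p i ≤ p (i + 1) := fun i => by
    simp only [p]; push_cast; nlinarith [hd n]
  have hmono : Monotone p := monotone_nat_of_le_succ hpm
  have hint : IntervalIntegrable (fun s => q (r n s) s) volume 0 t := by
    refine hB.mono_fun (by rw [uIoc_of_le ht.le]; exact hmeas _ (hrm n)) ?_
    rw [uIoc_of_le ht.le]
    filter_upwards [ae_restrict_mem measurableSet_Ioc] with s hs
    exact (hqB s hs _ ⟨hr1 n s, hr3 n s hs.2⟩).trans (le_abs_self _)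
  have hsum : ∑ i ∈ Finset.range (n + 1), ∫ s in (p i)..(p (i + 1)), q (r n s) s =
      ∫ s in (0 : ℝ)..t, q (r n s) s := by
    rw [intervalIntegral.sum_integral_adjacent_intervals, hp0, hpn]
    intro i hi
    refine hint.mono_set ?_
    rw [uIcc_of_le (hpm i), uIcc_of_le ht.le]
    refine Icc_subset_Icc ?_ ?_
    · rw [← hp0]; exact hmono (Nat.zero_le _)
    · rw [← hpn]; exact hmono hi
  rw [← hsum, ← hpn, ← hp0, ← Finset.sum_range_sub (fun i => φ (p i))]
  refine Finset.sum_le_sum fun i hi => ?_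
  have hi' : i + 1 ≤ n + 1 := Finset.mem_range.1 hi
  refine (hφ (p i) (p (i + 1)) ?_ (hpm i) ?_).trans_eq ?_
  · rw [← hp0]; exact hmono (Nat.zero_le _)
  · rw [← hpn]; exact hmono hi'
  · rw [intervalIntegral.integral_of_le (hpm i), intervalIntegral.integral_of_le (hpm i)]
    refine setIntegral_congr_fun measurableSet_Ioc fun s hs => ?_
    have hc : ⌈s / (t / (n + 1 : ℝ))⌉ = (i + 1 : ℤ) := by
      rw [Int.ceil_eq_iff, lt_div_iff₀ (hd n), div_le_iff₀ (hd n)]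
      have h1 := hs.1
      have h2 := hs.2
      simp only [p] at h1 h2
      push_cast at h1 h2 ⊢
      exact ⟨by linarith, h2⟩
    have : r n s = p (i + 1) := by
      simp only [r, p, hc]; push_cast; ring
    simp only [this]

end IntegralInequalities

/-! ### Quasi-contractive semigroups and mild solutions -/

section Mild

variable {H : Type*} [NormedAddCommGroup H] [InnerProductSpace ℝ H]

/-- A quasi-contractive `C₀`-semigroup, extended by the identity to negative times. -/
structure IsQuasiContractive (S : ℝ → H →L[ℝ] H) (lam : ℝ) : Prop where
  of_nonpos : ∀ t ≤ 0, S t = ContinuousLinearMap.id ℝ H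
  add : ∀ s t : ℝ, 0 ≤ s → 0 ≤ t → S (s + t) = (S s).comp (S t)
  continuous : Continuous fun p : ℝ × H => S p.1 p.2
  nonneg : 0 ≤ lam
  bound : ∀ t : ℝ, 0 ≤ t → ‖S t‖ ≤ Real.exp (lam * t)

/-- Right continuity at `0` and the exponential bound force joint strong continuity. Freezing the
operator at negative times keeps `S (t - s)` jointly continuous for all real `s`. -/
lemma IsC0Semigroup.isQuasiContractive {S : ℝ → H →L[ℝ] H} (hS : IsC0Semigroup S) {lam : ℝ}
    (hlam : 0 ≤ lam) (hb : ∀ t : ℝ, 0 ≤ t → ‖S t‖ ≤ Real.exp (lam * t)) :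
    IsQuasiContractive (fun t => S (max t 0)) lam := by
  have hadd : ∀ s t : ℝ, 0 ≤ s → 0 ≤ t → S (s + t) = (S s).comp (S t) := hS.add
  -- The factor at the smaller time would suffice; keeping both makes the bound symmetric in `s` and
  -- `t`.
  have hincr : ∀ (x : H) (s t : ℝ), 0 ≤ s → 0 ≤ t →
      ‖S t x - S s x‖ ≤ Real.exp (lam * s) * Real.exp (lam * t) * ‖S |t - s| x - x‖ := by
    intro x s t hs ht
    wlog hst : s ≤ t generalizing s t
    · rw [norm_sub_rev, abs_sub_comm, mul_comm (Real.exp _)]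
      exact this t s ht hs (le_of_not_ge hst)
    have h1 : S t x = S s (S (t - s) x) := by
      have := hadd s (t - s) hs (by linarith)
      rw [add_sub_cancel] at this
      rw [this]; rfl
    rw [abs_of_nonneg (sub_nonneg.2 hst), h1, ← map_sub]
    refine ((S s).le_opNorm _).trans ?_
    refine mul_le_mul_of_nonneg_right ((hb s hs).trans ?_) (norm_nonneg _)
    exact le_mul_of_one_le_right (Real.exp_pos _).le (Real.one_le_exp (by positivity))
  refine ⟨fun t ht => ?_, fun s t hs ht => ?_, ?_, hlam, fun t ht => ?_⟩
  · simp only [max_eq_right ht, hS.zero]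
  · simp only [max_eq_left hs, max_eq_left ht, max_eq_left (add_nonneg hs ht), hadd s t hs ht]
  · rw [continuous_iff_continuousAt]
    rintro ⟨t₀, x₀⟩
    rw [ContinuousAt, tendsto_iff_norm_sub_tendsto_zero]
    have h0 : Tendsto (fun r => ‖S r x₀ - x₀‖) (𝓝[≥] 0) (𝓝 0) := by
      rw [← Ioi_union_left, nhdsWithin_union, nhdsWithin_singleton, tendsto_sup]
      constructor
      · rw [← tendsto_iff_norm_sub_tendsto_zero]; exact hS.tendsto_zero x₀
      · rw [tendsto_pure_left]
        intro s hs
        simpa [hS.zero] using mem_of_mem_nhds hs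
    have h1 : Tendsto (fun p : ℝ × H => |max p.1 0 - max t₀ 0|) (𝓝 (t₀, x₀)) (𝓝[≥] 0) := by
      refine tendsto_nhdsWithin_iff.2 ⟨?_, Eventually.of_forall fun p => mem_Ici.2 (abs_nonneg _)⟩
      have : Continuous fun p : ℝ × H => |max p.1 0 - max t₀ 0| := by fun_prop
      simpa using this.tendsto (t₀, x₀)
    have h2 : Continuous fun p : ℝ × H => Real.exp (lam * max p.1 0) * ‖p.2 - x₀‖ := by fun_prop
    have h3 : Continuous fun p : ℝ × H =>
      Real.exp (lam * max t₀ 0) * Real.exp (lam * max p.1 0) := by fun_prop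
    have h4 := (h2.tendsto (t₀, x₀)).add ((h3.tendsto (t₀, x₀)).mul (h0.comp h1))
    simp only [sub_self, norm_zero, mul_zero, add_zero] at h4
    refine squeeze_zero (fun _ => norm_nonneg _) (fun p => ?_) h4
    calc ‖S (max p.1 0) p.2 - S (max t₀ 0) x₀‖
        = ‖S (max p.1 0) (p.2 - x₀) + (S (max p.1 0) x₀ - S (max t₀ 0) x₀)‖ := by
          rw [map_sub]; congr 1; abel
      _ ≤ _ := (norm_add_le _ _).trans (add_le_add
          (((S _).le_opNorm _).trans (mul_le_mul_of_nonneg_right (hb _ (le_max_right _ _))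
            (norm_nonneg _))) (hincr x₀ _ _ (le_max_right _ _) (le_max_right _ _)))
  · simp only [max_eq_left ht]; exact hb t ht

/-- The mild solution `S(t) x + ∫₀ᵗ S(t - s) F(s) ds` of `z' = A z + F`, `z(0) = x`. -/
noncomputable def mild (S : ℝ → H →L[ℝ] H) (x : H) (F : ℝ → H) (t : ℝ) : H :=
  S t x + ∫ s in (0 : ℝ)..t, S (t - s) (F s)

namespace IsQuasiContractive

variable {S : ℝ → H →L[ℝ] H} {lam : ℝ} (hS : IsQuasiContractive S lam)

include hS

lemma norm_le {t c : ℝ} (hc : 0 ≤ c) (h : t ≤ c) : ‖S t‖ ≤ Real.exp (lam * c) := by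
  rcases le_total t 0 with ht | ht
  · rw [hS.of_nonpos t ht]
    exact ContinuousLinearMap.norm_id_le.trans (Real.one_le_exp (mul_nonneg hS.nonneg hc))
  · exact (hS.bound t ht).trans (Real.exp_le_exp.2 (mul_le_mul_of_nonneg_left h hS.nonneg))

lemma norm_apply_le {t c : ℝ} (hc : 0 ≤ c) (h : t ≤ c) (x : H) :
    ‖S t x‖ ≤ Real.exp (lam * c) * ‖x‖ :=
  ((S t).le_opNorm x).trans (mul_le_mul_of_nonneg_right (hS.norm_le hc h) (norm_nonneg _))

lemma aestronglyMeasurable {F : ℝ → H} {μ : Measure ℝ} {θ : ℝ → ℝ} (hθ : Measurable θ)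
    (hF : AEStronglyMeasurable F μ) : AEStronglyMeasurable (fun s => S (θ s) (F s)) μ :=
  hS.continuous.comp_aestronglyMeasurable (hθ.aestronglyMeasurable.prodMk hF)

lemma intervalIntegrable {F : ℝ → H} {a b c : ℝ} {θ : ℝ → ℝ} (hθ : Measurable θ) (hc : 0 ≤ c)
    (hθc : ∀ s ∈ uIoc a b, θ s ≤ c) (hF : IntervalIntegrable F volume a b) :
    IntervalIntegrable (fun s => S (θ s) (F s)) volume a b := by
  refine (hF.norm.const_mul (Real.exp (lam * c))).mono_fun
    (hS.aestronglyMeasurable hθ hF.def'.aestronglyMeasurable) ?_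
  filter_upwards [ae_restrict_mem measurableSet_uIoc] with s hs
  exact (hS.norm_apply_le hc (hθc s hs) _).trans (le_abs_self _)

lemma intervalIntegrable_sub {F : ℝ → H} (hF : ∀ a b, IntervalIntegrable F volume a b)
    (t a b : ℝ) : IntervalIntegrable (fun s => S (t - s) (F s)) volume a b := by
  refine hS.intervalIntegrable (c := |t| + |a| + |b|) (by fun_prop) (by positivity) ?_ (hF a b)
  intro s hs
  have h1 : min a b ≤ s := hs.1.le
  have := neg_abs_le a
  have := neg_abs_le b
  have := le_abs_self t
  have := abs_nonneg a
  have := abs_nonneg b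
  rcases min_le_iff.1 h1 with h | h <;> linarith

lemma mild_zero (x : H) (F : ℝ → H) : mild S x F 0 = x := by
  simp [mild, hS.of_nonpos 0 le_rfl]

lemma mild_sub {F F' : ℝ → H} (hF : ∀ a b, IntervalIntegrable F volume a b)
    (hF' : ∀ a b, IntervalIntegrable F' volume a b) (x x' : H) (t : ℝ) :
    mild S x F t - mild S x' F' t = mild S (x - x') (fun s => F s - F' s) t := by
  simp only [mild, map_sub]
  rw [intervalIntegral.integral_sub (hS.intervalIntegrable_sub hF t 0 t)
    (hS.intervalIntegrable_sub hF' t 0 t)]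
  abel

lemma continuous_mild {F : ℝ → H} (hF : ∀ a b, IntervalIntegrable F volume a b) (x : H) :
    Continuous (mild S x F) := by
  have hI := hS.intervalIntegrable_sub hF
  refine Continuous.add (hS.continuous.comp (continuous_id.prodMk continuous_const)) ?_
  rw [continuous_iff_continuousAt]
  intro t₀
  set T := |t₀| + 1
  have hT : 0 ≤ T := by positivity
  have ht₀ : t₀ < T := by have := le_abs_self t₀; simp only [T]; linarith
  -- As `S` is the identity at negative times, the upper limit can be fixed at `T`, so that `t`
  -- stays in the integrand, where dominated convergence applies, and in a plain primitive of `F`.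
  have heq : (fun t => ∫ s in (0 : ℝ)..t, S (t - s) (F s)) =ᶠ[𝓝 t₀]
      fun t => (∫ s in (0 : ℝ)..T, S (t - s) (F s)) - ∫ s in t..T, F s := by
    filter_upwards [Iio_mem_nhds ht₀] with t ht
    rw [eq_sub_iff_add_eq, ← intervalIntegral.integral_add_adjacent_intervals (hI t 0 t) (hI t t T)]
    congr 1
    refine intervalIntegral.integral_congr fun s hs => ?_
    rw [uIcc_of_le (le_of_lt ht)] at hs
    simp [hS.of_nonpos (t - s) (by linarith [hs.1])]
  refine ContinuousAt.congr ?_ heq.symm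
  refine ContinuousAt.sub ?_ ?_
  · refine intervalIntegral.continuousAt_of_dominated_interval
      (bound := fun s => Real.exp (lam * T) * ‖F s‖) ?_ ?_ ((hF 0 T).norm.const_mul _) ?_
    · exact Eventually.of_forall fun t => (hI t 0 T).def'.aestronglyMeasurable
    · filter_upwards [Iio_mem_nhds ht₀] with t ht
      refine ae_of_all _ fun s hs => ?_
      rw [uIoc_of_le hT] at hs
      exact hS.norm_apply_le hT (by linarith [hs.1, mem_Iio.1 ht]) _
    · refine ae_of_all _ fun s _ => Continuous.continuousAt ?_
      exact hS.continuous.comp ((continuous_id.sub continuous_const).prodMk continuous_const)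
  · have : (fun t => ∫ s in t..T, F s) = fun t => -∫ s in T..t, F s := by
      ext t; rw [intervalIntegral.integral_symm]
    rw [this]
    exact (intervalIntegral.continuous_primitive hF T).neg.continuousAt

variable [CompleteSpace H]

lemma mild_eq {F : ℝ → H} (hF : ∀ a b, IntervalIntegrable F volume a b) (x : H) {a b : ℝ}
    (ha : 0 ≤ a) (hab : a ≤ b) :
    mild S x F b = S (b - a) (mild S x F a) + ∫ s in a..b, S (b - s) (F s) := by
  have hI := hS.intervalIntegrable_sub hF
  have h1 : S b x = S (b - a) (S a x) := by
    have := hS.add (b - a) a (by linarith) ha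
    rw [sub_add_cancel] at this
    rw [this]; rfl
  have h2 : S (b - a) (∫ s in (0 : ℝ)..a, S (a - s) (F s)) =
      ∫ s in (0 : ℝ)..a, S (b - s) (F s) := by
    rw [← ContinuousLinearMap.intervalIntegral_comp_comm _ (hI a 0 a)]
    refine intervalIntegral.integral_congr fun s hs => ?_
    rw [uIcc_of_le ha] at hs
    have := hS.add (b - a) (a - s) (by linarith) (by linarith [hs.2])
    rw [sub_add_sub_cancel] at this
    simp only [this, ContinuousLinearMap.comp_apply]
  rw [mild, mild, map_add, h2, ← h1, add_assoc,
    intervalIntegral.integral_add_adjacent_intervals (hI b 0 a) (hI b a b)]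

/-- The energy inequality for mild solutions. -/
lemma exp_mul_norm_mild_sq_le {F : ℝ → H} (hF : ∀ a b, IntervalIntegrable F volume a b) (x : H)
    {t : ℝ} (ht : 0 ≤ t) :
    Real.exp (-(2 * lam * t)) * ‖mild S x F t‖ ^ 2 ≤ ‖x‖ ^ 2 +
      ∫ s in (0 : ℝ)..t, 2 * Real.exp (-(2 * lam * s)) * inner ℝ (F s) (mild S x F s) := by
  have hI := hS.intervalIntegrable_sub hF
  have hz := hS.continuous_mild hF x
  set z := mild S x F
  obtain ⟨Z, hZ⟩ := isCompact_Icc.exists_bound_of_continuousOn (hz.continuousOn (s := Icc 0 t))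
  have key := sub_le_integral_diag (φ := fun t => Real.exp (-(2 * lam * t)) * ‖z t‖ ^ 2)
    (B := fun s => 2 * Real.exp (lam * t) * Z * ‖F s‖)
    (q := fun r s => 2 * Real.exp (-(2 * lam * r)) * inner ℝ (S (r - s) (F s)) (z r)) ht
    ?_ ?_ ((hF 0 t).norm.const_mul _) ?_ ?_
  · simp only [mul_zero, neg_zero, Real.exp_zero, one_mul, sub_self, hS.of_nonpos 0 le_rfl,
      ContinuousLinearMap.id_apply] at key
    rw [show z 0 = x from hS.mild_zero x F] at key
    linarith
  · intro a b ha hab _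
    set q := S (b - a) (z a)
    set r := ∫ s in a..b, S (b - s) (F s)
    have hzb : z b = q + r := hS.mild_eq hF x ha hab
    have h1 : ∫ s in a..b, 2 * Real.exp (-(2 * lam * b)) * inner ℝ (S (b - s) (F s)) (z b) =
        2 * Real.exp (-(2 * lam * b)) * inner ℝ (z b) r := by
      rw [intervalIntegral.integral_const_mul]
      congr 1
      simp_rw [real_inner_comm (z b)]
      exact ContinuousLinearMap.intervalIntegral_comp_comm (innerSL ℝ (z b)) (hI b a b)
    rw [h1]
    -- Expanding around the endpoint `z b` gives the quadratic remainder a negative sign, so it is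
    -- dropped rather than shown to be small.
    have h2 : ‖z b‖ ^ 2 = ‖q‖ ^ 2 + 2 * inner ℝ (z b) r - ‖r‖ ^ 2 := by
      rw [hzb, norm_add_sq_real, inner_add_left, real_inner_self_eq_norm_sq]; ring
    have h3 : ‖q‖ ^ 2 ≤ Real.exp (2 * lam * (b - a)) * ‖z a‖ ^ 2 := by
      calc ‖q‖ ^ 2 ≤ (Real.exp (lam * (b - a)) * ‖z a‖) ^ 2 := by
            gcongr; exact hS.norm_apply_le (by linarith) le_rfl _
        _ = _ := by rw [mul_pow, ← Real.exp_nat_mul]; congr 2; push_cast; ring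
    have h4 : Real.exp (-(2 * lam * b)) * Real.exp (2 * lam * (b - a)) =
        Real.exp (-(2 * lam * a)) := by rw [← Real.exp_add]; congr 1; ring
    have h5 := mul_le_mul_of_nonneg_left h3 (Real.exp_pos (-(2 * lam * b))).le
    rw [← mul_assoc, h4] at h5
    have h6 : 0 ≤ Real.exp (-(2 * lam * b)) * ‖r‖ ^ 2 := by positivity
    simp only [h2]
    nlinarith
  · intro r hr
    refine AEStronglyMeasurable.mul ?_ ?_
    · exact Measurable.aestronglyMeasurable (by fun_prop)
    · exact (hS.aestronglyMeasurable (hr.sub measurable_id)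
        (by simpa [uIoc_of_le ht] using (hF 0 t).def'.aestronglyMeasurable)).inner
        (hz.comp_aestronglyMeasurable hr.aestronglyMeasurable)
  · intro s hs r hr
    have hr0 : 0 ≤ r := hs.1.le.trans hr.1
    have h1 : Real.exp (-(2 * lam * r)) ≤ 1 := by
      have := mul_nonneg hS.nonneg hr0
      rw [Real.exp_le_one_iff]; linarith
    have h2 : ‖S (r - s) (F s)‖ ≤ Real.exp (lam * t) * ‖F s‖ :=
      hS.norm_apply_le ht (by linarith [hs.1, hr.2]) _
    have h3 := hZ r ⟨hr0, hr.2⟩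
    rw [norm_mul, norm_mul, Real.norm_of_nonneg (Real.exp_pos _).le, Real.norm_two]
    calc 2 * Real.exp (-(2 * lam * r)) * ‖inner ℝ (S (r - s) (F s)) (z r)‖
        ≤ 2 * 1 * ((Real.exp (lam * t) * ‖F s‖) * Z) := by
          gcongr
          exact (norm_inner_le_norm _ _).trans (by gcongr)
      _ = _ := by ring
  · intro s _
    refine Continuous.continuousAt ?_
    refine Continuous.mul (by fun_prop) (Continuous.inner ?_ hz)
    exact hS.continuous.comp ((continuous_id.sub continuous_const).prodMk continuous_const)

/-- Stability of mild solutions under a one-sided bound along a path close to the solution. -/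
lemma norm_mild_sq_le {F p : ℝ → H} (hF : ∀ a b, IntervalIntegrable F volume a b) (x : H)
    {k κ : ℝ → ℝ} (hk : ∀ a b, IntervalIntegrable k volume a b) (hk0 : ∀ s, 0 ≤ k s)
    (hκ : ∀ a b, IntervalIntegrable κ volume a b) {ε b τ : ℝ} (hε : 0 ≤ ε) (hb : 0 ≤ b)
    (hp : ∀ s ∈ Icc 0 τ, ‖p s - mild S x F s‖ ≤ ε)
    (hFp : ∀ s ∈ Icc 0 τ, inner ℝ (F s) (p s) ≤ k s * (‖p s‖ ^ 2 + b))
    (hFκ : ∀ s ∈ Icc 0 τ, ‖F s‖ ≤ κ s) {t : ℝ} (ht : t ∈ Icc 0 τ) :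
    ‖mild S x F t‖ ^ 2 ≤ Real.exp (2 * lam * τ) * Real.exp (4 * ∫ s in (0 : ℝ)..τ, k s) *
      (‖x‖ ^ 2 + (4 * ε ^ 2 + 2 * b) * (∫ s in (0 : ℝ)..τ, k s) +
        2 * ε * ∫ s in (0 : ℝ)..τ, κ s) := by
  have hz := hS.continuous_mild hF x
  set z := mild S x F
  set A := ‖x‖ ^ 2 + (4 * ε ^ 2 + 2 * b) * (∫ s in (0 : ℝ)..τ, k s) +
        2 * ε * ∫ s in (0 : ℝ)..τ, κ s
  set φ : ℝ → ℝ := fun s => Real.exp (-(2 * lam * s)) * ‖z s‖ ^ 2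
  have hφ : Continuous φ := by fun_prop
  have hτ : 0 ≤ τ := ht.1.trans ht.2
  have hmono : ∀ {j : ℝ → ℝ}, (∀ a b, IntervalIntegrable j volume a b) →
      (∀ s ∈ Icc 0 τ, 0 ≤ j s) → ∀ r ∈ Icc 0 τ, ∫ s in (0 : ℝ)..r, j s ≤ ∫ s in (0 : ℝ)..τ, j s := by
    intro j hj hj0 r hr
    rw [← intervalIntegral.integral_add_adjacent_intervals (hj 0 r) (hj r τ)]
    have := intervalIntegral.integral_nonneg (μ := volume) hr.2 fun s hs => hj0 s ⟨hr.1.trans hs.1, hs.2⟩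
    linarith
  have hκ0 : ∀ s ∈ Icc 0 τ, 0 ≤ κ s := fun s hs => (norm_nonneg _).trans (hFκ s hs)
  have hA0 : 0 ≤ A := by
    have h1 := intervalIntegral.integral_nonneg (μ := volume) hτ fun s _ => hk0 s
    have h2 := intervalIntegral.integral_nonneg (μ := volume) hτ hκ0
    positivity
  have hineq : ∀ r ∈ Icc 0 t, φ r ≤ A + ∫ s in (0 : ℝ)..r, (4 * k s) * φ s := by
    intro r hr
    have hrτ : r ∈ Icc 0 τ := ⟨hr.1, hr.2.trans ht.2⟩
    have hJ : IntervalIntegrable (fun s => (4 * k s) * φ s) volume 0 r :=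
      ((hk 0 r).const_mul 4).mul_continuousOn hφ.continuousOn
    have hJ2 : IntervalIntegrable (fun s => (4 * ε ^ 2 + 2 * b) * k s) volume 0 r :=
      (hk 0 r).const_mul _
    have hJ3 : IntervalIntegrable (fun s => 2 * ε * κ s) volume 0 r := (hκ 0 r).const_mul _
    have hJ4 : IntervalIntegrable
        (fun s => 2 * Real.exp (-(2 * lam * s)) * inner ℝ (F s) (z s)) volume 0 r := by
      obtain ⟨Z, hZ⟩ := isCompact_Icc.exists_bound_of_continuousOn (hz.continuousOn (s := Icc 0 r))
      have : IntervalIntegrable (fun s => inner ℝ (F s) (z s)) volume 0 r := by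
        refine ((hF 0 r).norm.const_mul Z).mono_fun ?_ ?_
        · exact (hF 0 r).def'.aestronglyMeasurable.inner hz.aestronglyMeasurable
        · filter_upwards [ae_restrict_mem measurableSet_uIoc] with s hs
          rw [uIoc_of_le hr.1] at hs
          refine (norm_inner_le_norm _ _).trans (le_trans ?_ (le_abs_self _))
          rw [mul_comm]
          exact mul_le_mul_of_nonneg_right (hZ s (Ioc_subset_Icc_self hs)) (norm_nonneg _)
      exact this.continuousOn_mul (Continuous.continuousOn (by fun_prop))
    have h1 := hS.exp_mul_norm_mild_sq_le hF x hr.1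
    have h2 : ∫ s in (0 : ℝ)..r, 2 * Real.exp (-(2 * lam * s)) * inner ℝ (F s) (z s) ≤
        ∫ s in (0 : ℝ)..r, ((4 * k s) * φ s + (4 * ε ^ 2 + 2 * b) * k s + 2 * ε * κ s) := by
      refine intervalIntegral.integral_mono_on hr.1 hJ4 ((hJ.add hJ2).add hJ3) fun s hs => ?_
      have hs' : s ∈ Icc 0 τ := ⟨hs.1, hs.2.trans hrτ.2⟩
      have e0 := Real.exp_pos (-(2 * lam * s))
      have e1 : Real.exp (-(2 * lam * s)) ≤ 1 := by
        have := mul_nonneg hS.nonneg hs.1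
        rw [Real.exp_le_one_iff]; linarith
      -- The one-sided bound is available at `p s` only; moving to `z s` costs `ε * κ s`, and `‖p‖²
      -- ≤ 2‖z‖² + 2ε²`. With the factor 2 of the energy inequality this gives the kernel `4 * k`.
      have a1 : inner ℝ (F s) (z s) ≤
          k s * (2 * ‖z s‖ ^ 2 + 2 * ε ^ 2 + b) + ε * κ s := by
        have b1 : inner ℝ (F s) (z s) = inner ℝ (F s) (p s) - inner ℝ (F s) (p s - z s) := by
          rw [inner_sub_right]; ring
        have b2 : -(ε * κ s) ≤ inner ℝ (F s) (p s - z s) := by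
          have := (abs_real_inner_le_norm (F s) (p s - z s)).trans
            (mul_le_mul (hFκ s hs') (hp s hs') (norm_nonneg _) (hκ0 s hs'))
          linarith [neg_abs_le (inner ℝ (F s) (p s - z s))]
        have b3 : ‖p s‖ ^ 2 ≤ 2 * ‖z s‖ ^ 2 + 2 * ε ^ 2 := by
          have c1 : ‖p s‖ ≤ ‖z s‖ + ε := by
            have := norm_add_le (z s) (p s - z s)
            rw [add_sub_cancel] at this
            linarith [hp s hs']
          nlinarith [sq_nonneg (‖z s‖ - ε), norm_nonneg (p s), norm_nonneg (z s)]
        have b4 := hFp s hs'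
        have b5 : k s * (‖p s‖ ^ 2 + b) ≤ k s * (2 * ‖z s‖ ^ 2 + 2 * ε ^ 2 + b) :=
          mul_le_mul_of_nonneg_left (by linarith) (hk0 s)
        linarith
      have a2 : 0 ≤ (4 * ε ^ 2 + 2 * b) * k s + 2 * ε * κ s := by
        have := hk0 s
        have := hκ0 s hs'
        positivity
      calc 2 * Real.exp (-(2 * lam * s)) * inner ℝ (F s) (z s)
          ≤ 2 * Real.exp (-(2 * lam * s)) *
            (k s * (2 * ‖z s‖ ^ 2 + 2 * ε ^ 2 + b) + ε * κ s) := by gcongr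
        _ = (4 * k s) * φ s + Real.exp (-(2 * lam * s)) *
            ((4 * ε ^ 2 + 2 * b) * k s + 2 * ε * κ s) := by simp only [φ]; ring
        _ ≤ (4 * k s) * φ s + 1 * ((4 * ε ^ 2 + 2 * b) * k s + 2 * ε * κ s) := by gcongr
        _ = _ := by ring
    rw [intervalIntegral.integral_add (hJ.add hJ2) hJ3, intervalIntegral.integral_add hJ hJ2,
      intervalIntegral.integral_const_mul, intervalIntegral.integral_const_mul] at h2
    have h3 := mul_le_mul_of_nonneg_left (hmono hk (fun s _ => hk0 s) r hrτ)
      (show 0 ≤ 4 * ε ^ 2 + 2 * b by positivity)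
    have h4 := mul_le_mul_of_nonneg_left (hmono hκ hκ0 r hrτ) (show 0 ≤ 2 * ε by positivity)
    simp only [A]
    linarith
  have h1 := le_mul_exp_of_le_add_integral ht.1 ((hk 0 t).const_mul 4)
    (fun s => mul_nonneg zero_le_four (hk0 s)) hφ hineq
  rw [intervalIntegral.integral_const_mul] at h1
  have h2 : Real.exp (4 * ∫ s in (0 : ℝ)..t, k s) ≤ Real.exp (4 * ∫ s in (0 : ℝ)..τ, k s) :=
    Real.exp_le_exp.2 (by linarith [hmono hk (fun s _ => hk0 s) t ht])
  have h3 : Real.exp (2 * lam * t) ≤ Real.exp (2 * lam * τ) :=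
    Real.exp_le_exp.2 (mul_le_mul_of_nonneg_left ht.2 (mul_nonneg zero_le_two hS.nonneg))
  calc ‖z t‖ ^ 2 = Real.exp (2 * lam * t) * φ t := by
        simp only [φ]; rw [← mul_assoc, ← Real.exp_add]; simp
    _ ≤ Real.exp (2 * lam * τ) * (A * Real.exp (4 * ∫ s in (0 : ℝ)..τ, k s)) := by
        gcongr
        exact h1.trans (by gcongr)
    _ = _ := by ring

end IsQuasiContractive

end Mild

/-! ### Existence of mild solutions for one-sided Lipschitz nonlinearities -/

section Existence

variable {H : Type*} [NormedAddCommGroup H] [InnerProductSpace ℝ H]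

/-- A demicontinuous nonlinearity `G(s, x)` which is one-sided Lipschitz in `x` with constant `k(s)`
and bounded by `κ R s` on the ball of radius `R`. -/
structure IsOneSidedLipschitz (G : ℝ → H → H) (k : ℝ → ℝ) (κ : ℝ → ℝ → ℝ) : Prop where
  aestronglyMeasurable : ∀ y : ℝ → H, Continuous y →
    AEStronglyMeasurable (fun s => G s (y s)) volume
  k_integrable : ∀ a b, IntervalIntegrable k volume a b
  k_nonneg : ∀ s, 0 ≤ k s
  κ_integrable : ∀ R a b, IntervalIntegrable (κ R) volume a b
  norm_le : ∀ R s x, ‖x‖ ≤ R → ‖G s x‖ ≤ κ R s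
  inner_le : ∀ s x y, inner ℝ (G s x - G s y) (x - y) ≤ k s * ‖x - y‖ ^ 2
  demicontinuous : ∀ s, Demicontinuous (G s)

namespace IsOneSidedLipschitz

variable {G : ℝ → H → H} {k : ℝ → ℝ} {κ : ℝ → ℝ → ℝ} (hG : IsOneSidedLipschitz G k κ)

include hG

lemma intervalIntegrable {y : ℝ → H} (hy : Continuous y) (a b : ℝ) :
    IntervalIntegrable (fun s => G s (y s)) volume a b := by
  obtain ⟨R, hR⟩ := isCompact_uIcc.exists_bound_of_continuousOn (hy.continuousOn (s := uIcc a b))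
  refine (hG.κ_integrable R a b).mono_fun (hG.aestronglyMeasurable y hy).restrict ?_
  filter_upwards [ae_restrict_mem measurableSet_uIoc] with s hs
  exact (hG.norm_le R s _ (hR s (uIoc_subset_uIcc hs))).trans (le_abs_self _)

lemma κ_zero_nonneg (s : ℝ) : 0 ≤ κ 0 s :=
  (norm_nonneg _).trans (hG.norm_le 0 s 0 (by simp))

/-- Compare with the value at `0` and use `‖p‖ ≤ ‖p‖² + 1`. Only `κ 0` occurs, so a priori bounds do
not see the growth of `G` on large balls. -/
lemma inner_self_le (s : ℝ) (p : H) :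
    inner ℝ (G s p) p ≤ (k s + κ 0 s) * (‖p‖ ^ 2 + 1) := by
  have h1 := hG.inner_le s p 0
  rw [sub_zero, inner_sub_left] at h1
  have h2 : inner ℝ (G s 0) p ≤ κ 0 s * ‖p‖ := (real_inner_le_norm _ _).trans
    (mul_le_mul_of_nonneg_right (hG.norm_le 0 s 0 (by simp)) (norm_nonneg _))
  have h3 : κ 0 s * ‖p‖ ≤ κ 0 s * (‖p‖ ^ 2 + 1) :=
    mul_le_mul_of_nonneg_left (by nlinarith [sq_nonneg (‖p‖ - 1)]) (hG.κ_zero_nonneg s)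
  have h4 := hG.k_nonneg s
  nlinarith

end IsOneSidedLipschitz

lemma mild_congr {S : ℝ → H →L[ℝ] H} {x : H} {F F' : ℝ → H} {t : ℝ} (ht : 0 ≤ t)
    (h : ∀ s ∈ Icc 0 t, F s = F' s) : mild S x F t = mild S x F' t := by
  unfold mild
  congr 1
  refine intervalIntegral.integral_congr fun s hs => ?_
  rw [uIcc_of_le ht] at hs
  simp only [h s hs]

/-- The path `z` delayed by `δ` and transported back by the semigroup. -/
noncomputable def delayed (S : ℝ → H →L[ℝ] H) (δ : ℝ) (z : ℝ → H) (s : ℝ) : H :=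
  S (min s δ) (z (max (s - δ) 0))

namespace IsQuasiContractive

variable {S : ℝ → H →L[ℝ] H} {lam : ℝ} (hS : IsQuasiContractive S lam)
  {G : ℝ → H → H} {k : ℝ → ℝ} {κ : ℝ → ℝ → ℝ} (hG : IsOneSidedLipschitz G k κ)

include hS

lemma continuous_delayed (δ : ℝ) {z : ℝ → H} (hz : Continuous z) :
    Continuous (delayed S δ z) :=
  hS.continuous.comp ((continuous_id.min continuous_const).prodMk
    (hz.comp ((continuous_id.sub continuous_const).max continuous_const)))

include hG in
-- Method of steps: the delayed forcing on `[0, (j + 1)δ]` involves the path on `[0, jδ]` only, so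
-- each application of `Φ` settles one more interval of length `δ`.
lemma exists_delay_solution (x : H) {δ : ℝ} (hδ : 0 < δ) (n : ℕ) :
    ∃ z : ℝ → H, Continuous z ∧
      ∀ t ∈ Icc 0 (n * δ), z t = mild S x (fun s => G s (delayed S δ z s)) t := by
  set Φ : (ℝ → H) → ℝ → H := fun z => mild S x (fun s => G s (delayed S δ z s))
  set Z : ℕ → ℝ → H := fun j => Φ^[j] fun _ => x
  have hsucc : ∀ j, Z (j + 1) = Φ (Z j) := fun j => Function.iterate_succ_apply' _ _ _
  have hcont : ∀ j, Continuous (Z j) := by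
    intro j
    induction j with
    | zero => exact continuous_const
    | succ j ih =>
      rw [hsucc]
      exact hS.continuous_mild (hG.intervalIntegrable (hS.continuous_delayed δ ih)) x
  have hstab : ∀ j : ℕ, ∀ t ∈ Icc 0 (j * δ), Z (j + 1) t = Z j t := by
    intro j
    induction j with
    | zero =>
      intro t ht
      obtain rfl : t = 0 := by
        have h2 := ht.2
        simp only [Nat.cast_zero, zero_mul] at h2
        exact le_antisymm h2 ht.1
      rw [hsucc]; exact hS.mild_zero _ _
    | succ j ih =>
      intro t ht
      rw [hsucc (j + 1), hsucc j]
      refine mild_congr ht.1 fun s hs => ?_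
      have h2 := ht.2
      push_cast at h2
      have : max (s - δ) 0 ∈ Icc 0 (j * δ) := by
        refine ⟨le_max_right _ _, max_le ?_ (by positivity)⟩
        linarith [hs.2]
      have e := ih _ this
      rw [hsucc] at e
      simp only [delayed, e]
  refine ⟨Z n, hcont n, fun t ht => ?_⟩
  rw [← hstab n t ht, hsucc]

variable [CompleteSpace H]

/-- Restart the mild solution at `max (s - δ) 0`: since the delayed path carries the semigroup
factor, the difference is exactly the forcing integral over the last stretch, and no modulus of
continuity of `z` is needed. -/
lemma norm_delayed_sub_le (x : H) {F : ℝ → H} (hF : ∀ a b, IntervalIntegrable F volume a b)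
    {j : ℝ → ℝ} (hj : ∀ a b, IntervalIntegrable j volume a b) {δ τ : ℝ} (hδ : 0 ≤ δ)
    {z : ℝ → H} (hz : ∀ s ∈ Icc 0 τ, z s = mild S x F s) (hFj : ∀ s ∈ Icc 0 τ, ‖F s‖ ≤ j s)
    {s : ℝ} (hs : s ∈ Icc 0 τ) :
    ‖delayed S δ z s - mild S x F s‖ ≤
      Real.exp (lam * τ) * ∫ r in (max (s - δ) 0)..s, j r := by
  have ha : max (s - δ) 0 ≤ s := max_le (by linarith) hs.1
  have ha0 : 0 ≤ max (s - δ) 0 := le_max_right _ _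
  have hmin : s - max (s - δ) 0 = min s δ := by
    rcases le_total s δ with h | h
    · rw [max_eq_right (by linarith), min_eq_left h, sub_zero]
    · rw [max_eq_left (by linarith), min_eq_right h, sub_sub_cancel]
  rw [hS.mild_eq hF x ha0 ha, hmin, delayed, hz _ ⟨ha0, ha.trans hs.2⟩, sub_add_cancel_left,
    norm_neg, ← intervalIntegral.integral_const_mul]
  refine intervalIntegral.norm_integral_le_of_norm_le ha (ae_of_all _ fun r hr => ?_)
    ((hj _ _).const_mul _)
  have hr' : r ∈ Icc 0 τ := ⟨ha0.trans hr.1.le, hr.2.trans hs.2⟩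
  exact (hS.norm_apply_le (hs.1.trans hs.2) (by linarith [hr'.1, hs.2]) _).trans
    (mul_le_mul_of_nonneg_left (hFj r hr') (Real.exp_pos _).le)

include hG in
/-- Approximate solutions of `z = mild S x (G(z))`, uniformly bounded on `[0, T]`. -/
lemma exists_approx (x : H) {T : ℝ} (hT : 0 < T) :
    ∃ R : ℝ, ∀ η : ℝ, 0 < η → ∃ z y : ℝ → H, Continuous z ∧ Continuous y ∧ ∀ s ∈ Icc 0 T,
      ‖y s‖ ≤ R ∧ z s = mild S x (fun s => G s (y s)) s ∧ ‖y s - z s‖ ≤ η := by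
  set k' : ℝ → ℝ := fun s => k s + κ 0 s
  have hk' : ∀ a b, IntervalIntegrable k' volume a b := fun a b =>
    (hG.k_integrable a b).add (hG.κ_integrable 0 a b)
  have hk'0 : ∀ s, 0 ≤ k' s := fun s => add_nonneg (hG.k_nonneg s) (hG.κ_zero_nonneg s)
  have hK'0 : 0 ≤ ∫ s in (0 : ℝ)..T, k' s :=
    intervalIntegral.integral_nonneg hT.le fun s _ => hk'0 s
  -- The bound of `norm_mild_sq_le` with `b = 1`, `ε ≤ 1` and `ε ∫ κ R' ≤ 1`: then `4ε² + 2b ≤ 6`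
  -- and the last term is at most 2.
  set R2 := Real.exp (2 * lam * T) * Real.exp (4 * ∫ s in (0 : ℝ)..T, k' s) *
      (‖x‖ ^ 2 + 6 * (∫ s in (0 : ℝ)..T, k' s) + 2) with hR2
  have hR20 : 0 ≤ R2 := by positivity
  set R := √R2
  have hxR : ‖x‖ ≤ R := by
    refine Real.le_sqrt_of_sq_le ?_
    have h1 : 1 ≤ Real.exp (2 * lam * T) :=
      Real.one_le_exp (mul_nonneg (mul_nonneg zero_le_two hS.nonneg) hT.le)
    have h2 : 1 ≤ Real.exp (4 * ∫ s in (0 : ℝ)..T, k' s) := Real.one_le_exp (by positivity)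
    have h3 := one_le_mul_of_one_le_of_one_le h1 h2
    nlinarith [sq_nonneg ‖x‖]
  -- The delayed path is `S (min s δ)` applied to a value of `z`, so it may exceed `R` by this
  -- factor. There is no circularity: `R` involves only `κ 0`, and `ε` is chosen after `R'`.
  set R' := Real.exp (lam * T) * R
  have hRR' : R ≤ R' := le_mul_of_one_le_left (Real.sqrt_nonneg _)
    (Real.one_le_exp (mul_nonneg hS.nonneg hT.le))
  have hR0 : 0 ≤ R := Real.sqrt_nonneg _
  have hj0 : ∀ s, 0 ≤ κ R' s := fun s =>
    (norm_nonneg _).trans (hG.norm_le R' s 0 (by simpa using hR0.trans hRR'))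
  have hJ0 : 0 ≤ ∫ s in (0 : ℝ)..T, κ R' s :=
    intervalIntegral.integral_nonneg hT.le fun s _ => hj0 s
  refine ⟨R', fun η hη => ?_⟩
  set ε := min η (min 1 (1 / ((∫ s in (0 : ℝ)..T, κ R' s) + 1)))
  have hε : 0 < ε := lt_min hη (lt_min one_pos (by positivity))
  have hε1 : ε ≤ 1 := (min_le_right _ _).trans (min_le_left _ _)
  have hεJ : ε * (∫ s in (0 : ℝ)..T, κ R' s) ≤ 1 := by
    have h1 : ε ≤ 1 / ((∫ s in (0 : ℝ)..T, κ R' s) + 1) :=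
      (min_le_right _ _).trans (min_le_right _ _)
    rw [le_div_iff₀ (by positivity)] at h1
    linarith
  obtain ⟨δ₀, hδ₀, hP⟩ := Metric.uniformContinuousOn_iff.1
    (isCompact_Icc.uniformContinuousOn_of_continuous
      (intervalIntegral.continuous_primitive (hG.κ_integrable R') 0).continuousOn (s := Icc 0 T))
    (ε / Real.exp (lam * T)) (by positivity)
  obtain ⟨n, hn⟩ := exists_nat_one_div_lt (div_pos hδ₀ hT)
  set δ := T / (n + 1)
  have hδ : 0 < δ := by positivity
  have hδδ₀ : δ < δ₀ := by
    rw [lt_div_iff₀ hT] at hn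
    simpa [δ, div_eq_mul_inv, mul_comm] using hn
  have hnδ : ((n + 1 : ℕ) : ℝ) * δ = T := by
    push_cast; exact mul_div_cancel₀ _ (by positivity)
  have hsmall : ∀ s ∈ Icc 0 T, Real.exp (lam * T) * ∫ r in (max (s - δ) 0)..s, κ R' r ≤ ε := by
    intro s hs
    have hmem : max (s - δ) 0 ∈ Icc 0 T := ⟨le_max_right _ _, max_le (by linarith [hs.2]) hT.le⟩
    have h1 := hP s hs _ hmem ?_
    · rw [Real.dist_eq, intervalIntegral.integral_interval_sub_left (hG.κ_integrable R' _ _)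
        (hG.κ_integrable R' _ _)] at h1
      have h2 := (le_abs_self _).trans h1.le
      rwa [le_div_iff₀' (Real.exp_pos _)] at h2
    · rw [Real.dist_eq, abs_of_nonneg (sub_nonneg.2 (max_le (by linarith) hs.1))]
      linarith [le_max_left (s - δ) 0]
  obtain ⟨z, hz, hzeq⟩ := hS.exists_delay_solution hG x hδ (n + 1)
  rw [hnδ] at hzeq
  have hy := hS.continuous_delayed δ hz
  set F : ℝ → H := fun s => G s (delayed S δ z s)
  have hF : ∀ a b, IntervalIntegrable F volume a b := hG.intervalIntegrable hy
  have hstep : ∀ τ ∈ Icc 0 T, (∀ s ∈ Icc 0 (τ - δ), ‖z s‖ ≤ R) → ‖z 0‖ ≤ R →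
      ∀ s ∈ Icc 0 τ, ‖delayed S δ z s‖ ≤ R' := by
    intro τ hτ h h0 s hs
    refine (hS.norm_apply_le hT.le ((min_le_left _ _).trans (hs.2.trans hτ.2)) _).trans ?_
    refine mul_le_mul_of_nonneg_left ?_ (Real.exp_pos _).le
    rcases le_total (s - δ) 0 with h1 | h1
    · rwa [max_eq_right h1]
    · rw [max_eq_left h1]; exact h _ ⟨h1, by linarith [hs.2]⟩
  have hclose : ∀ τ ∈ Icc 0 T, (∀ s ∈ Icc 0 τ, ‖delayed S δ z s‖ ≤ R') →
      ∀ s ∈ Icc 0 τ, ‖delayed S δ z s - mild S x F s‖ ≤ ε := by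
    intro τ hτ h s hs
    have hsT : s ∈ Icc 0 T := ⟨hs.1, hs.2.trans hτ.2⟩
    refine (hS.norm_delayed_sub_le x hF (hG.κ_integrable R') hδ.le (τ := τ)
      (fun r hr => hzeq r ⟨hr.1, hr.2.trans hτ.2⟩)
      (fun r hr => hG.norm_le R' r _ (h r hr)) hs).trans (le_trans ?_ (hsmall s hsT))
    refine mul_le_mul_of_nonneg_right (Real.exp_le_exp.2
      (mul_le_mul_of_nonneg_left hτ.2 hS.nonneg)) ?_
    exact intervalIntegral.integral_nonneg (max_le (by linarith) hs.1) fun r _ => hj0 r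
  have hz0 : ‖z 0‖ ≤ R := by
    rw [hzeq 0 ⟨le_rfl, hT.le⟩, hS.mild_zero]; exact hxR
  -- A bound on `[0, jδ]` bounds the delayed path on `[0, (j + 1)δ]`; there the stability estimate
  -- returns the same constant `R`, so the bound does not deteriorate from step to step.
  have hbd : ∀ j : ℕ, j ≤ n + 1 → ∀ s ∈ Icc 0 (j * δ), ‖z s‖ ≤ R := by
    intro j
    induction j with
    | zero =>
      intro _ s hs
      obtain rfl : s = 0 := le_antisymm (by simpa using hs.2) hs.1
      exact hz0
    | succ j ih =>
      intro hj s hs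
      set τ := ((j + 1 : ℕ) : ℝ) * δ
      have hτ : τ ∈ Icc 0 T := by
        refine ⟨by positivity, ?_⟩
        rw [← hnδ]
        exact mul_le_mul_of_nonneg_right (by exact_mod_cast hj) hδ.le
      have h1 := hstep τ hτ (by
        have : τ - δ = j * δ := by simp only [τ]; push_cast; ring
        rw [this]; exact ih (by omega)) hz0
      have h2 := hS.norm_mild_sq_le hF x hk' hk'0 (hG.κ_integrable R') hε.le zero_le_one
        (hclose τ hτ h1) (fun s _ => hG.inner_self_le s _)
        (fun s hs => hG.norm_le R' s _ (h1 s hs)) hs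
      rw [hzeq s ⟨hs.1, hs.2.trans hτ.2⟩]
      refine Real.le_sqrt_of_sq_le (h2.trans ?_)
      have hmono : ∀ {i : ℝ → ℝ}, (∀ a b, IntervalIntegrable i volume a b) → (∀ s, 0 ≤ i s) →
          ∫ s in (0 : ℝ)..τ, i s ≤ ∫ s in (0 : ℝ)..T, i s := fun hi hi0 =>
        intervalIntegral.integral_mono_interval le_rfl hτ.1 hτ.2 (ae_of_all _ hi0) (hi _ _)
      have m1 := hmono hk' hk'0
      have m2 := hmono (hG.κ_integrable R') hj0
      have m3 : 0 ≤ ∫ s in (0 : ℝ)..τ, k' s :=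
        intervalIntegral.integral_nonneg hτ.1 fun s _ => hk'0 s
      have m4 : 0 ≤ ∫ s in (0 : ℝ)..τ, κ R' s :=
        intervalIntegral.integral_nonneg hτ.1 fun s _ => hj0 s
      have m5 : lam * τ ≤ lam * T := mul_le_mul_of_nonneg_left hτ.2 hS.nonneg
      rw [hR2]
      gcongr Real.exp ?_ * Real.exp ?_ * (_ + ?_ + ?_)
      · linarith
      · linarith
      · have : ε ^ 2 ≤ 1 := pow_le_one₀ hε.le hε1
        calc (4 * ε ^ 2 + 2 * 1) * ∫ s in (0 : ℝ)..τ, k' s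
            ≤ (4 * 1 + 2 * 1) * ∫ s in (0 : ℝ)..T, k' s := by gcongr
          _ = _ := by ring
      · have := mul_le_mul_of_nonneg_left m2 hε.le
        linarith
  have hbdT : ∀ s ∈ Icc 0 T, ‖z s‖ ≤ R := by
    have := hbd (n + 1) le_rfl
    rwa [hnδ] at this
  have hyR := hstep T ⟨hT.le, le_rfl⟩
    (fun s hs => hbdT s ⟨hs.1, by linarith [hs.2]⟩) hz0
  refine ⟨z, delayed S δ z, hz, hy, fun s hs => ⟨hyR s hs, hzeq s hs, ?_⟩⟩
  rw [hzeq s hs]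
  exact (hclose T ⟨hT.le, le_rfl⟩ hyR s hs).trans (min_le_left _ _)

include hG in
/-- Existence of a mild solution of `z' = A z + G(t, z)`, `z(0) = x`, on `[0, T]`. -/
theorem exists_mild_solution (x : H) {T : ℝ} (hT : 0 < T) :
    ∃ z : ℝ → H, Continuous z ∧
      ∀ t ∈ Icc 0 T, z t = mild S x (fun s => G s (z s)) t := by
  obtain ⟨R, hR⟩ := hS.exists_approx hG x hT
  have hη0 : ∀ n : ℕ, (0 : ℝ) < 1 / (n + 1) := fun n => by positivity
  choose z y hz hy hzy using fun n : ℕ => hR (1 / (n + 1)) (hη0 n)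
  have hR0 : 0 ≤ R := (norm_nonneg _).trans (hzy 0 0 ⟨le_rfl, hT.le⟩).1
  have hFint : ∀ n, ∀ a b, IntervalIntegrable (fun s => G s (y n s)) volume a b :=
    fun n => hG.intervalIntegrable (hy n)
  set K := ∫ s in (0 : ℝ)..T, k s
  set J := ∫ s in (0 : ℝ)..T, 2 * κ R s
  set W := Real.exp (2 * lam * T) * Real.exp (4 * K)
  set bd : ℕ → ℝ := fun n => √(W * (4 * (2 * (1 / (n + 1 : ℝ))) ^ 2 * K +
    2 * (2 * (1 / (n + 1 : ℝ))) * J))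
  -- Stability for the difference: the forcings are evaluated at `y n` and `y m`, and `y n - y m` is
  -- within `2 / (N + 1)` of `z n - z m`; the one-sided Lipschitz bound gives `b = 0`.
  have hest : ∀ N n m : ℕ, N ≤ n → N ≤ m → ∀ t ∈ Icc 0 T, ‖z n t - z m t‖ ≤ bd N := by
    intro N n m hn hm t ht
    have e1 : ∀ i : ℕ, N ≤ i → (1 / (i + 1 : ℝ)) ≤ 1 / (N + 1) := fun i hi =>
      one_div_le_one_div_of_le (by positivity) (by gcongr)
    rw [(hzy n t ht).2.1, (hzy m t ht).2.1, hS.mild_sub (hFint n) (hFint m), sub_self]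
    have h := hS.norm_mild_sq_le (p := fun s => y n s - y m s)
      (fun a b => (hFint n a b).sub (hFint m a b)) 0
      hG.k_integrable hG.k_nonneg (fun a b => (hG.κ_integrable R a b).const_mul 2)
      (ε := 2 * (1 / (N + 1))) (b := 0) (τ := T) (by positivity) le_rfl ?_ ?_ ?_ ht
    · refine Real.le_sqrt_of_sq_le (h.trans_eq ?_)
      simp only [norm_zero, K, J, W]
      ring
    · intro s hs
      rw [← sub_self x, ← hS.mild_sub (hFint n) (hFint m), ← (hzy n s hs).2.1,
        ← (hzy m s hs).2.1, sub_sub_sub_comm]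
      refine (norm_sub_le _ _).trans ?_
      linarith [(hzy n s hs).2.2, (hzy m s hs).2.2, e1 n hn, e1 m hm]
    · intro s _
      rw [add_zero]
      exact hG.inner_le s _ _
    · intro s hs
      refine (norm_sub_le _ _).trans ?_
      linarith [hG.norm_le R s _ (hzy n s hs).1, hG.norm_le R s _ (hzy m s hs).1]
  have hbd : Tendsto bd atTop (𝓝 0) := by
    have h0 : Tendsto (fun n : ℕ => (1 / (n + 1 : ℝ))) atTop (𝓝 0) :=
      tendsto_one_div_add_atTop_nhds_zero_nat
    have hc : Continuous fun η : ℝ => √(W * (4 * (2 * η) ^ 2 * K + 2 * (2 * η) * J)) := by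
      fun_prop
    simpa [bd, Function.comp_def] using (hc.tendsto 0).comp h0
  set Z : ℕ → C(Icc (0 : ℝ) T, H) := fun n => ⟨fun t => z n t, (hz n).comp continuous_subtype_val⟩
  have hZ : CauchySeq Z := by
    refine cauchySeq_of_le_tendsto_0 bd (fun n m N hn hm => ?_) hbd
    refine (ContinuousMap.dist_le (Real.sqrt_nonneg _)).2 fun t => ?_
    rw [dist_eq_norm]
    exact hest N n m hn hm t t.2
  obtain ⟨ζ, hζ⟩ := cauchySeq_tendsto_of_complete hZ
  have hzlim : ∀ s ∈ Icc 0 T, Tendsto (fun n => z n s) atTop (𝓝 (IccExtend hT.le ζ s)) := by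
    intro s hs
    rw [IccExtend_of_mem _ _ hs]
    exact ((continuous_eval_const (⟨s, hs⟩ : Icc (0 : ℝ) T)).tendsto ζ).comp hζ
  have hylim : ∀ s ∈ Icc 0 T, Tendsto (fun n => y n s) atTop (𝓝 (IccExtend hT.le ζ s)) := by
    intro s hs
    have h1 : Tendsto (fun n => y n s - z n s) atTop (𝓝 0) :=
      squeeze_zero_norm (fun n => (hzy n s hs).2.2) tendsto_one_div_add_atTop_nhds_zero_nat
    simpa using h1.add (hzlim s hs)
  have hζc : Continuous (IccExtend hT.le ζ) := ζ.continuous.Icc_extend'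
  refine ⟨IccExtend hT.le ζ, hζc, fun t ht => ?_⟩
  have hI := fun F hF => hS.intervalIntegrable_sub (F := F) hF t 0 t
  -- Demicontinuity gives only weak convergence of the integrands, so the equation is tested against
  -- `v` and passed to the limit by dominated convergence.
  refine ext_inner_left ℝ fun v => ?_
  have h1 : Tendsto (fun n => inner ℝ v (z n t)) atTop (𝓝 (inner ℝ v (IccExtend hT.le ζ t))) :=
    tendsto_const_nhds.inner (hzlim t ht)
  refine tendsto_nhds_unique h1 ?_
  have hrep : ∀ w : ℝ → H, Continuous w → inner ℝ v (mild S x (fun s => G s (w s)) t) =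
      inner ℝ v (S t x) + ∫ s in (0 : ℝ)..t, inner ℝ v (S (t - s) (G s (w s))) := by
    intro w hw
    rw [mild, inner_add_right]
    congr 1
    exact (ContinuousLinearMap.intervalIntegral_comp_comm (innerSL ℝ v)
      (hI _ (hG.intervalIntegrable hw))).symm
  rw [hrep _ hζc]
  refine Tendsto.congr (fun n => by rw [(hzy n t ht).2.1, hrep _ (hy n)]) ?_
  refine tendsto_const_nhds.add ?_
  refine intervalIntegral.tendsto_integral_filter_of_dominated_convergence
    (fun s => ‖v‖ * (Real.exp (lam * T) * κ R s)) ?_ ?_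
    (((hG.κ_integrable R 0 t).const_mul _).const_mul _) ?_
  · exact Eventually.of_forall fun n => aestronglyMeasurable_const.inner
      (hI _ (hFint n)).def'.aestronglyMeasurable
  · refine Eventually.of_forall fun n => ae_of_all _ fun s hs => ?_
    rw [uIoc_of_le ht.1] at hs
    have hs' : s ∈ Icc 0 T := ⟨hs.1.le, hs.2.trans ht.2⟩
    refine (norm_inner_le_norm _ _).trans (mul_le_mul_of_nonneg_left ?_ (norm_nonneg _))
    refine (hS.norm_apply_le hT.le (by linarith [hs.1, ht.2]) _).trans ?_
    exact mul_le_mul_of_nonneg_left (hG.norm_le R s _ (hzy n s hs').1) (Real.exp_pos _).le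
  · refine ae_of_all _ fun s hs => ?_
    rw [uIoc_of_le ht.1] at hs
    have hs' : s ∈ Icc 0 T := ⟨hs.1.le, hs.2.trans ht.2⟩
    have h := hG.demicontinuous s _ _ (hylim s hs') (ContinuousLinearMap.adjoint (S (t - s)) v)
    simpa only [ContinuousLinearMap.adjoint_inner_right, real_inner_comm v] using h

end IsQuasiContractive

end Existence

/-! ### Hilbert-Schmidt operators are norm limits of operators of finite rank -/

section HilbertSchmidtApprox

variable {U H : Type*} [NormedAddCommGroup U] [InnerProductSpace ℝ U] [CompleteSpace U]
  [NormedAddCommGroup H] [InnerProductSpace ℝ H]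

lemma hsNorm_sq (B : U →L[ℝ] H) : hsNorm B ^ 2 = ∑' i, ‖B (onb U i)‖ₑ ^ 2 := by
  rw [hsNorm, ← ENNReal.rpow_natCast, ← ENNReal.rpow_mul]
  norm_num

/-- Expand `B x` in a basis of `H`, move `B` to its adjoint and apply Cauchy–Schwarz termwise; the
sum for the adjoint equals the one for `B`. -/
lemma enorm_le_hsNorm [CompleteSpace H] (B : U →L[ℝ] H) : ‖B‖ₑ ≤ hsNorm B := by
  have hx : ∀ x, ‖B x‖ₑ ≤ hsNorm B * ‖x‖ₑ := by
    intro x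
    have h : ‖B x‖ₑ ^ 2 ≤ (hsNorm B * ‖x‖ₑ) ^ 2 := by
      rw [mul_pow, hsNorm_sq, tsum_enorm_apply_sq (onb U), ← tsum_enorm_inner_sq (onb H),
        ← ENNReal.tsum_mul_right]
      refine ENNReal.tsum_le_tsum fun j => ?_
      rw [← mul_pow, ← ContinuousLinearMap.adjoint_inner_left]
      gcongr
      rw [← ofReal_norm, ← ofReal_norm, ← ofReal_norm, ← ENNReal.ofReal_mul (norm_nonneg _)]
      exact ENNReal.ofReal_le_ofReal (norm_inner_le_norm _ _)
    exact (ENNReal.pow_le_pow_left_iff two_ne_zero).1 h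
  by_cases hB : hsNorm B = ∞
  · rw [hB]; exact le_top
  · rw [← ofReal_norm, ← ENNReal.ofReal_toReal hB]
    refine ENNReal.ofReal_le_ofReal (B.opNorm_le_bound ENNReal.toReal_nonneg fun x => ?_)
    have h := ENNReal.toReal_mono (ENNReal.mul_ne_top hB enorm_ne_top) (hx x)
    simpa [ENNReal.toReal_mul] using h

/-- The operators of the form `∑ ⟨aᵢ, ·⟩ bᵢ`. -/
def finiteRankOperators (U H : Type*) [NormedAddCommGroup U] [InnerProductSpace ℝ U]
    [NormedAddCommGroup H] [InnerProductSpace ℝ H] : Submodule ℝ (U →L[ℝ] H) :=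
  Submodule.span ℝ {B | ∃ (a : U) (b : H), B = (innerSL ℝ a).smulRight b}

/-- Truncate to a finite set `F` of basis vectors: the squared Hilbert–Schmidt norm of the remainder
is the tail of a convergent sum, and it dominates the operator norm. -/
lemma IsHilbertSchmidt.mem_closure_finiteRankOperators [CompleteSpace H] {B : U →L[ℝ] H}
    (hB : IsHilbertSchmidt B) : B ∈ closure (finiteRankOperators U H : Set (U →L[ℝ] H)) := by
  classical
  set Q : Finset (onbIndex U) → U →L[ℝ] H := fun F =>
    ∑ i ∈ F, (innerSL ℝ (onb U i)).smulRight (B (onb U i))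
  have hQ : ∀ F, Q F ∈ (finiteRankOperators U H : Set (U →L[ℝ] H)) := fun F =>
    Submodule.sum_mem _ fun i _ => Submodule.subset_span ⟨_, _, rfl⟩
  have hfin : ∑' i, ‖B (onb U i)‖ₑ ^ 2 ≠ ∞ := by
    rw [← hsNorm_sq]; exact ENNReal.pow_ne_top hB.ne
  have happ : ∀ F i, (B - Q F) (onb U i) = if i ∈ F then 0 else B (onb U i) := by
    intro F i
    have : Q F (onb U i) = ∑ j ∈ F, if i = j then B (onb U j) else 0 := by
      simp only [Q, sum_apply, ContinuousLinearMap.smulRight_apply,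
        innerSL_apply_apply]
      refine Finset.sum_congr rfl fun j _ => ?_
      rw [orthonormal_iff_ite.1 (onb U).orthonormal j i]
      by_cases hij : i = j
      · simp [hij]
      · simp [hij, Ne.symm hij]
    rw [sub_apply, this, Finset.sum_ite_eq]
    split_ifs <;> simp
  have hle : ∀ F, ‖B - Q F‖ₑ ^ 2 ≤ ∑' i : {i // i ∉ F}, ‖B (onb U i)‖ₑ ^ 2 := by
    intro F
    refine (pow_le_pow_left' (enorm_le_hsNorm _) 2).trans_eq ?_
    rw [hsNorm_sq]
    refine Eq.trans ?_ (tsum_subtype {i | i ∉ F} fun i => ‖B (onb U i)‖ₑ ^ 2).symm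
    refine tsum_congr fun i => ?_
    rw [happ]
    by_cases hi : i ∈ F <;> simp [hi]
  have hlim : Tendsto (fun F => ‖B - Q F‖ₑ ^ 2) atTop (𝓝 0) :=
    tendsto_of_tendsto_of_tendsto_of_le_of_le tendsto_const_nhds
      (ENNReal.tendsto_tsum_compl_atTop_zero hfin) (fun _ => zero_le) hle
  have hlim' : Tendsto Q atTop (𝓝 B) := by
    rw [tendsto_iff_norm_sub_tendsto_zero]
    have h1 : Tendsto (fun F => ‖B - Q F‖ ^ 2) atTop (𝓝 0) := by
      have := (ENNReal.tendsto_toReal ENNReal.zero_ne_top).comp hlim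
      simpa [Function.comp_def] using this
    have h2 := (Real.continuous_sqrt.tendsto 0).comp h1
    simpa [Function.comp_def, Real.sqrt_sq, norm_sub_rev] using h2
  exact mem_closure_of_tendsto hlim' (Eventually.of_forall hQ)

omit [CompleteSpace U] in
/-- Norm limits of operators of finite rank are completely continuous. -/
lemma tendsto_zero_of_mem_closure_finiteRankOperators {ι : Type*} {l : Filter ι} {B : U →L[ℝ] H}
    (hB : B ∈ closure (finiteRankOperators U H : Set (U →L[ℝ] H))) {v : ι → U} {c : ℝ}
    (hv : ∀ i, ‖v i‖ ≤ c) (hv0 : ∀ y, Tendsto (fun i => inner ℝ y (v i)) l (𝓝 0)) :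
    Tendsto (fun i => B (v i)) l (𝓝 0) := by
  have hfin : ∀ Q ∈ finiteRankOperators U H, Tendsto (fun i => Q (v i)) l (𝓝 0) := by
    intro Q hQ
    induction hQ using Submodule.span_induction with
    | mem Q h =>
      obtain ⟨a, b, rfl⟩ := h
      simpa using (hv0 a).smul_const b
    | zero => simpa using tendsto_const_nhds
    | add P Q _ _ hP hQ => simpa using hP.add hQ
    | smul r Q _ hQ => simpa using hQ.const_smul r
  rw [Metric.tendsto_nhds]
  intro ε hε
  have hc : 0 < |c| + 1 := by positivity
  obtain ⟨Q, hQ, hBQ⟩ := Metric.mem_closure_iff.1 hB (ε / 2 / (|c| + 1)) (by positivity)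
  filter_upwards [Metric.tendsto_nhds.1 (hfin Q hQ) (ε / 2) (by positivity)] with i hi
  rw [dist_zero_right] at hi ⊢
  have h1 : ‖(B - Q) (v i)‖ ≤ ε / 2 := by
    refine ((B - Q).le_opNorm _).trans ?_
    rw [dist_eq_norm] at hBQ
    calc ‖B - Q‖ * ‖v i‖ ≤ ε / 2 / (|c| + 1) * (|c| + 1) := by
          gcongr
          exact (hv i).trans ((le_abs_self c).trans (by linarith))
      _ = ε / 2 := div_mul_cancel₀ _ hc.ne'
  have h2 : B (v i) = (B - Q) (v i) + Q (v i) := by simp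
  rw [h2]
  exact (norm_add_le _ _).trans_lt (by linarith)

omit [CompleteSpace U] in
/-- A strongly continuous family composed with norm limits of operators of finite rank is norm
continuous. -/
lemma IsQuasiContractive.continuous_comp {S : ℝ → H →L[ℝ] H} {lam : ℝ}
    (hS : IsQuasiContractive S lam) {X : Type*} [TopologicalSpace X] {B : X → U →L[ℝ] H}
    (hBc : Continuous B) (hB : ∀ x, B x ∈ closure (finiteRankOperators U H : Set (U →L[ℝ] H))) :
    Continuous fun p : ℝ × X => (S p.1).comp (B p.2) := by
  -- Strong continuity becomes norm continuity on rank one operators, as `S r` acts only on the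
  -- vector `b`.
  have hfin : ∀ Q ∈ finiteRankOperators U H, Continuous fun r => (S r).comp Q := by
    intro Q hQ
    induction hQ using Submodule.span_induction with
    | mem Q h =>
      obtain ⟨a, b, rfl⟩ := h
      have h1 : ∀ r, (S r).comp ((innerSL ℝ a).smulRight b) = (innerSL ℝ a).smulRight (S r b) := by
        intro r; ext x; simp
      simp only [h1]
      have h2 : Continuous fun r => S r b :=
        hS.continuous.comp (continuous_id.prodMk continuous_const)
      exact ((ContinuousLinearMap.smulRightL ℝ U H (innerSL ℝ a)).continuous.comp h2)
    | zero => simpa using continuous_const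
    | add P Q _ _ hP hQ => simp only [ContinuousLinearMap.comp_add]; exact hP.add hQ
    | smul r Q _ hQ => simp only [ContinuousLinearMap.comp_smul]; exact hQ.const_smul r
  rw [continuous_iff_continuousAt]
  rintro ⟨r₀, x₀⟩
  -- One `Q` near `B x₀` serves a whole neighbourhood, because `‖S r‖ ≤ c` for `r < |r₀| + 1`.
  refine continuousAt_of_locally_uniform_approx_of_continuousAt fun V hV => ?_
  obtain ⟨ε, hε, hεV⟩ := Metric.mem_uniformity_dist.1 hV
  set c := Real.exp (lam * (|r₀| + 1))
  have hc : 0 < c := Real.exp_pos _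
  obtain ⟨Q, hQ, hBQ⟩ := Metric.mem_closure_iff.1 (hB x₀) (ε / c) (by positivity)
  refine ⟨{p | p.1 < |r₀| + 1 ∧ dist (B p.2) Q < ε / c}, ?_, fun p => (S p.1).comp Q,
    ((hfin Q hQ).comp continuous_fst).continuousAt, fun p hp => hεV ?_⟩
  · refine IsOpen.mem_nhds ?_ ⟨by have := le_abs_self r₀; simp only; linarith, hBQ⟩
    exact (isOpen_lt continuous_fst continuous_const).inter
      (isOpen_lt ((hBc.comp continuous_snd).dist continuous_const) continuous_const)
  · rw [dist_eq_norm, ← ContinuousLinearMap.comp_sub]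
    have h1 := hp.2
    rw [dist_eq_norm, lt_div_iff₀' hc] at h1
    refine lt_of_le_of_lt ?_ h1
    exact (ContinuousLinearMap.opNorm_comp_le _ _).trans
      (mul_le_mul_of_nonneg_right (hS.norm_le (by positivity) hp.1.le) (norm_nonneg _))

end HilbertSchmidtApprox

/-! ### Convolution with weakly null controls -/

section Convolution

variable {U H : Type*} [NormedAddCommGroup U] [InnerProductSpace ℝ U]
  [NormedAddCommGroup H] [InnerProductSpace ℝ H]

omit [InnerProductSpace ℝ U] in
-- Integrate `‖w‖ ≤ 1/η + η‖w‖²`. A small `η` followed by a short interval makes the `L¹` norm small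
-- uniformly over an `L²` ball.
lemma integral_norm_le_of_integral_norm_sq_le {w : ℝ → U} {a b η c : ℝ} (hab : a ≤ b) (hη : 0 < η)
    (hw : IntervalIntegrable w volume a b)
    (hw2 : IntervalIntegrable (fun s => ‖w s‖ ^ 2) volume a b)
    (hc : ∫ s in a..b, ‖w s‖ ^ 2 ≤ c) :
    ∫ s in a..b, ‖w s‖ ≤ (b - a) / η + η * c := by
  have h1 : ∫ s in a..b, ‖w s‖ ≤ ∫ s in a..b, (η⁻¹ + η * ‖w s‖ ^ 2) := by
    refine intervalIntegral.integral_mono_on hab hw.norm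
      (intervalIntegrable_const.add (hw2.const_mul η)) fun s _ => ?_
    have h2 : 0 ≤ η⁻¹ * ((η * ‖w s‖ - 1) ^ 2 + η * ‖w s‖) := by positivity
    have h3 : η⁻¹ * ((η * ‖w s‖ - 1) ^ 2 + η * ‖w s‖) = η⁻¹ + η * ‖w s‖ ^ 2 - ‖w s‖ := by
      field_simp; ring
    linarith
  rw [intervalIntegral.integral_add intervalIntegrable_const (hw2.const_mul η),
    intervalIntegral.integral_const, intervalIntegral.integral_const_mul, smul_eq_mul] at h1
  have := mul_le_mul_of_nonneg_left hc hη.le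
  rw [div_eq_mul_inv]
  linarith

lemma intervalIntegrable_clm_apply {Ψ : ℝ → U →L[ℝ] H} (hΨ : Continuous Ψ) {w : ℝ → U} {a b : ℝ}
    (hw : IntervalIntegrable w volume a b) :
    IntervalIntegrable (fun s => Ψ s (w s)) volume a b := by
  obtain ⟨R, hR⟩ := isCompact_uIcc.exists_bound_of_continuousOn (hΨ.continuousOn (s := uIcc a b))
  refine (hw.norm.const_mul R).mono_fun ?_ ?_
  · have hc : Continuous fun p : (U →L[ℝ] H) × U => p.1 p.2 := isBoundedBilinearMap_apply.continuous
    exact hc.comp_aestronglyMeasurable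
      (hΨ.aestronglyMeasurable.prodMk hw.def'.aestronglyMeasurable)
  · filter_upwards [ae_restrict_mem measurableSet_uIoc] with s hs
    refine ((Ψ s).le_opNorm _).trans (le_trans ?_ (le_abs_self _))
    exact mul_le_mul_of_nonneg_right (hR s (uIoc_subset_uIcc hs)) (norm_nonneg _)

variable [CompleteSpace U] [CompleteSpace H]

/-- Freeze `Ψ` at the left end of each cell of a fine grid: `Ψ (p j)` then acts on the increments of
the primitive of `w i`, which are bounded and weakly null. The freezing error is the oscillation of
`Ψ` times the `L¹` bound. -/
lemma tendsto_integral_zero_of_weakly_null {ι : Type*} {l : Filter ι} {w : ι → ℝ → U}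
    {Ψ : ℝ → U →L[ℝ] H} {t c : ℝ} (ht : 0 ≤ t) (hΨ : Continuous Ψ)
    (hΨ0 : ∀ s (v : ι → U), (∃ c, ∀ i, ‖v i‖ ≤ c) →
      (∀ y, Tendsto (fun i => inner ℝ y (v i)) l (𝓝 0)) → Tendsto (fun i => Ψ s (v i)) l (𝓝 0))
    (hw : ∀ i a b, IntervalIntegrable (w i) volume a b)
    (hc : ∀ i, ∫ s in (0 : ℝ)..t, ‖w i s‖ ≤ c)
    (hw0 : ∀ v : U, ∀ a ∈ Icc 0 t, ∀ b ∈ Icc 0 t,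
      Tendsto (fun i => inner ℝ v (∫ s in a..b, w i s)) l (𝓝 0)) :
    Tendsto (fun i => ∫ s in (0 : ℝ)..t, Ψ s (w i s)) l (𝓝 0) := by
  rw [Metric.tendsto_nhds]
  intro ε hε
  set c' := |c| + 1
  have hc' : 0 < c' := by positivity
  obtain ⟨δ, hδ, hΨδ⟩ := Metric.uniformContinuousOn_iff.1
    (isCompact_Icc.uniformContinuousOn_of_continuous (hΨ.continuousOn (s := Icc 0 t)))
    (ε / 2 / c') (by positivity)
  obtain ⟨n, hn⟩ := exists_nat_one_div_lt (show 0 < δ / (t + 1) by positivity)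
  have hd : t / (n + 1) < δ := by
    rw [lt_div_iff₀ (by positivity)] at hn
    have h0 : (0 : ℝ) < 1 / (n + 1) := by positivity
    calc t / (n + 1) = 1 / (n + 1 : ℝ) * t := by ring
      _ ≤ 1 / (n + 1 : ℝ) * (t + 1) := by gcongr; linarith
      _ < δ := hn
  set p : ℕ → ℝ := fun j => j * (t / (n + 1))
  have hp0 : p 0 = 0 := by simp [p]
  have hpn : p (n + 1) = t := by
    simp only [p]; push_cast; exact mul_div_cancel₀ _ (by positivity)
  have hps : ∀ j, p (j + 1) = p j + t / (n + 1) := fun j => by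
    simp only [p]; push_cast; ring
  have hpm : ∀ j, p j ≤ p (j + 1) := fun j => by
    rw [hps]; have : 0 ≤ t / (n + 1) := by positivity
    linarith
  have hmono : Monotone p := monotone_nat_of_le_succ hpm
  have hmem : ∀ j ≤ n + 1, p j ∈ Icc 0 t := fun j hj =>
    ⟨hp0 ▸ hmono (Nat.zero_le _), hpn ▸ hmono hj⟩
  have hpart : ∀ j ≤ n + 1, ∀ k ≤ n + 1, ∃ c, ∀ i, ‖∫ s in (p j)..(p k), w i s‖ ≤ c := by
    intro j hj k hk
    refine ⟨c, fun i => ?_⟩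
    refine intervalIntegral.norm_integral_le_abs_integral_norm.trans ((le_trans ?_ (hc i)))
    rw [intervalIntegral.abs_integral_eq_abs_integral_uIoc, intervalIntegral.integral_of_le ht,
      abs_of_nonneg (integral_nonneg fun s => norm_nonneg _)]
    refine setIntegral_mono_set ?_ (ae_of_all _ fun s => norm_nonneg _)
      (LE.le.eventuallyLE ?_)
    · exact (intervalIntegrable_iff_integrableOn_Ioc_of_le ht).1 (hw i 0 t).norm
    · rw [← uIoc_of_le ht]
      exact uIoc_subset_uIoc_of_uIcc_subset_uIcc (by
        rw [uIcc_of_le ht]; exact uIcc_subset_Icc (hmem j hj) (hmem k hk))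
  have hsum : Tendsto (fun i => ∑ j ∈ Finset.range (n + 1),
      ‖Ψ (p j) (∫ s in (p j)..(p (j + 1)), w i s)‖) l (𝓝 0) := by
    rw [← Finset.sum_const_zero (s := Finset.range (n + 1))]
    refine tendsto_finsetSum _ fun j hj => ?_
    have hj' : j + 1 ≤ n + 1 := Finset.mem_range.1 hj
    have h1 := hΨ0 (p j) _ (hpart j (by omega) (j + 1) hj')
      (fun y => hw0 y _ (hmem j (by omega)) _ (hmem (j + 1) hj'))
    simpa using h1.norm
  filter_upwards [(tendsto_order.1 hsum).2 (ε / 2) (by positivity)] with i hi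
  rw [dist_zero_right]
  have hIΨ : ∀ a b, IntervalIntegrable (fun s => Ψ s (w i s)) volume a b := fun a b =>
    intervalIntegrable_clm_apply hΨ (hw i a b)
  have e1 : ∫ s in (0 : ℝ)..t, Ψ s (w i s) =
      ∑ j ∈ Finset.range (n + 1), ∫ s in (p j)..(p (j + 1)), Ψ s (w i s) := by
    rw [intervalIntegral.sum_integral_adjacent_intervals fun j _ => hIΨ _ _, hp0, hpn]
  have e2 : ∫ s in (0 : ℝ)..t, ‖w i s‖ =
      ∑ j ∈ Finset.range (n + 1), ∫ s in (p j)..(p (j + 1)), ‖w i s‖ := by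
    rw [intervalIntegral.sum_integral_adjacent_intervals fun j _ => (hw i _ _).norm, hp0, hpn]
  have e3 : ∀ j ∈ Finset.range (n + 1), ‖∫ s in (p j)..(p (j + 1)), Ψ s (w i s)‖ ≤
      ‖Ψ (p j) (∫ s in (p j)..(p (j + 1)), w i s)‖ +
        ε / 2 / c' * ∫ s in (p j)..(p (j + 1)), ‖w i s‖ := by
    intro j hj
    have hj' : j + 1 ≤ n + 1 := Finset.mem_range.1 hj
    have hIc : IntervalIntegrable (fun s => Ψ (p j) (w i s)) volume (p j) (p (j + 1)) :=
      intervalIntegrable_clm_apply continuous_const (hw i _ _)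
    rw [← ContinuousLinearMap.intervalIntegral_comp_comm _ (hw i _ _),
      ← intervalIntegral.integral_const_mul]
    have h1 : ∫ s in (p j)..(p (j + 1)), Ψ s (w i s) =
        (∫ s in (p j)..(p (j + 1)), Ψ (p j) (w i s)) +
          ∫ s in (p j)..(p (j + 1)), (Ψ s (w i s) - Ψ (p j) (w i s)) := by
      rw [intervalIntegral.integral_sub (hIΨ _ _) hIc]; abel
    rw [h1]
    refine (norm_add_le _ _).trans (add_le_add le_rfl ?_)
    refine intervalIntegral.norm_integral_le_of_norm_le (hpm j) (ae_of_all _ fun s hs => ?_)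
      ((hw i _ _).norm.const_mul _)
    rw [← sub_apply]
    refine ((Ψ s - Ψ (p j)).le_opNorm _).trans (mul_le_mul_of_nonneg_right ?_ (norm_nonneg _))
    rw [← dist_eq_norm]
    have hpj := hmem j (by omega)
    refine (hΨδ s ⟨hpj.1.trans hs.1.le, hs.2.trans (hmem _ hj').2⟩ _ hpj ?_).le
    rw [Real.dist_eq, abs_of_nonneg (by linarith [hs.1])]
    have := hs.2
    rw [hps] at this
    linarith
  rw [e1]
  calc _ ≤ ∑ j ∈ Finset.range (n + 1), ‖∫ s in (p j)..(p (j + 1)), Ψ s (w i s)‖ :=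
        norm_sum_le _ _
    _ ≤ _ := Finset.sum_le_sum e3
    _ = _ := by rw [Finset.sum_add_distrib, ← Finset.mul_sum, ← e2]
    _ ≤ _ + ε / 2 / c' * c' := by
        gcongr
        exact (hc i).trans ((le_abs_self c).trans (by simp only [c']; linarith))
    _ < ε := by rw [div_mul_cancel₀ _ hc'.ne']; linarith

/-- Pointwise convergence and equicontinuity in `t` on a compact interval give uniform convergence.
-/
lemma tendstoUniformlyOn_integral_zero_of_weakly_null {ι : Type*} {l : Filter ι} {w : ι → ℝ → U}
    {Φ : ℝ × ℝ → U →L[ℝ] H} {T c : ℝ} (hT : 0 ≤ T) (hΦ : Continuous Φ)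
    (hΦ0 : ∀ p (v : ι → U), (∃ c, ∀ i, ‖v i‖ ≤ c) →
      (∀ y, Tendsto (fun i => inner ℝ y (v i)) l (𝓝 0)) → Tendsto (fun i => Φ p (v i)) l (𝓝 0))
    (hw : ∀ i a b, IntervalIntegrable (w i) volume a b)
    (hw2 : ∀ i a b, IntervalIntegrable (fun s => ‖w i s‖ ^ 2) volume a b)
    (hc : ∀ i, ∫ s in (0 : ℝ)..T, ‖w i s‖ ^ 2 ≤ c)
    (hw0 : ∀ v : U, ∀ a ∈ Icc 0 T, ∀ b ∈ Icc 0 T,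
      Tendsto (fun i => inner ℝ v (∫ s in a..b, w i s)) l (𝓝 0)) :
    TendstoUniformlyOn (fun i t => ∫ s in (0 : ℝ)..t, Φ (t, s) (w i s)) 0 l (Icc 0 T) := by
  have hL1 : ∀ η > 0, ∀ i, ∀ a b, 0 ≤ a → a ≤ b → b ≤ T →
      ∫ s in a..b, ‖w i s‖ ≤ (b - a) / η + η * c := by
    intro η hη i a b ha hab hb
    refine integral_norm_le_of_integral_norm_sq_le hab hη (hw i a b) (hw2 i a b) ((hc i).trans' ?_)
    exact intervalIntegral.integral_mono_interval ha hab hb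
      (ae_of_all _ fun s => sq_nonneg _) (hw2 i _ _)
  obtain ⟨R, hR⟩ := (isCompact_Icc (a := ((0 : ℝ), (0 : ℝ))) (b := (T, T))).exists_bound_of_continuousOn
    hΦ.continuousOn
  have hR' : ∀ t ∈ Icc 0 T, ∀ s ∈ Icc 0 T, ‖Φ (t, s)‖ ≤ |R| := fun t ht s hs =>
    (hR (t, s) ⟨⟨ht.1, hs.1⟩, ⟨ht.2, hs.2⟩⟩).trans (le_abs_self R)
  set h : ι → ℝ → H := fun i t => ∫ s in (0 : ℝ)..t, Φ (t, s) (w i s)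
  have hI : ∀ i r a b, IntervalIntegrable (fun s => Φ (r, s) (w i s)) volume a b := fun i r a b =>
    intervalIntegrable_clm_apply (hΦ.comp (continuous_const.prodMk continuous_id)) (hw i a b)
  have hequi : ∀ ε > 0, ∃ δ > 0, ∀ i, ∀ t ∈ Icc 0 T, ∀ t' ∈ Icc 0 T, |t' - t| < δ →
      ‖h i t' - h i t‖ ≤ ε := by
    intro ε hε
    set c₁ := T / 1 + 1 * |c| + 1
    have hc₁ : 0 < c₁ := by positivity
    obtain ⟨δ₁, hδ₁, hΦδ⟩ := Metric.uniformContinuousOn_iff.1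
      (isCompact_Icc.uniformContinuousOn_of_continuous
        (hΦ.continuousOn (s := Icc ((0 : ℝ), (0 : ℝ)) (T, T)))) (ε / 2 / c₁) (by positivity)
    -- `η` makes the term `η * c` small in the `L¹` bound over `[t, t']`; then `δ₂` makes `(t' - t)
    -- / η` small. Kernel bound times `L¹` norm thus costs `ε / 2`, the kernel variation the other
    -- half.
    set η := ε / 4 / ((|R| + 1) * (|c| + 1))
    have hη : 0 < η := by positivity
    set δ₂ := ε / 4 / (|R| + 1) * η
    have hδ₂ : 0 < δ₂ := by positivity
    refine ⟨min δ₁ δ₂, lt_min hδ₁ hδ₂, fun i t ht t' ht' htt' => ?_⟩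
    wlog hle : t ≤ t' generalizing t t'
    · rw [norm_sub_rev]
      exact this t' ht' t ht (by rwa [abs_sub_comm]) (le_of_not_ge hle)
    rw [abs_of_nonneg (sub_nonneg.2 hle)] at htt'
    have e1 : h i t' - h i t = (∫ s in (0 : ℝ)..t, (Φ (t', s) (w i s) - Φ (t, s) (w i s))) +
        ∫ s in t..t', Φ (t', s) (w i s) := by
      rw [intervalIntegral.integral_sub (hI _ _ _ _) (hI _ _ _ _)]
      simp only [h]
      rw [← intervalIntegral.integral_add_adjacent_intervals (hI i t' 0 t) (hI i t' t t')]
      abel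
    have e2 : ‖∫ s in (0 : ℝ)..t, (Φ (t', s) (w i s) - Φ (t, s) (w i s))‖ ≤
        ε / 2 / c₁ * ∫ s in (0 : ℝ)..t, ‖w i s‖ := by
      rw [← intervalIntegral.integral_const_mul]
      refine intervalIntegral.norm_integral_le_of_norm_le ht.1 (ae_of_all _ fun s hs => ?_)
        ((hw i _ _).norm.const_mul _)
      rw [← sub_apply]
      refine ((Φ (t', s) - Φ (t, s)).le_opNorm _).trans
        (mul_le_mul_of_nonneg_right ?_ (norm_nonneg _))
      rw [← dist_eq_norm]
      have hs' : s ∈ Icc 0 T := ⟨hs.1.le, hs.2.trans ht.2⟩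
      refine (hΦδ (t', s) ⟨⟨ht'.1, hs'.1⟩, ⟨ht'.2, hs'.2⟩⟩ (t, s)
        ⟨⟨ht.1, hs'.1⟩, ⟨ht.2, hs'.2⟩⟩ ?_).le
      rw [Prod.dist_eq, dist_self, Real.dist_eq, abs_of_nonneg (sub_nonneg.2 hle)]
      exact max_lt (htt'.trans_le (min_le_left _ _)) hδ₁
    have e3 : ‖∫ s in t..t', Φ (t', s) (w i s)‖ ≤ |R| * ∫ s in t..t', ‖w i s‖ := by
      rw [← intervalIntegral.integral_const_mul]
      refine intervalIntegral.norm_integral_le_of_norm_le hle (ae_of_all _ fun s hs => ?_)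
        ((hw i _ _).norm.const_mul _)
      refine ((Φ (t', s)).le_opNorm _).trans (mul_le_mul_of_nonneg_right ?_ (norm_nonneg _))
      exact hR' t' ht' s ⟨ht.1.trans hs.1.le, hs.2.trans ht'.2⟩
    have e4 : ∫ s in (0 : ℝ)..t, ‖w i s‖ ≤ c₁ := by
      refine (hL1 1 one_pos i 0 t le_rfl ht.1 ht.2).trans ?_
      simp only [c₁]
      linarith [ht.2, le_abs_self c]
    have e5 : ∫ s in t..t', ‖w i s‖ ≤ ε / 2 / (|R| + 1) := by
      refine (hL1 η hη i t t' ht.1 hle ht'.2).trans ?_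
      have f1 : (t' - t) / η ≤ ε / 4 / (|R| + 1) := by
        rw [div_le_iff₀ hη]
        exact (htt'.trans_le (min_le_right _ _)).le
      have f2 : η * c ≤ ε / 4 / (|R| + 1) := by
        calc η * c ≤ η * (|c| + 1) := by gcongr; linarith [le_abs_self c]
          _ = ε / 4 / (|R| + 1) := by simp only [η]; field_simp
      have f3 : ε / 2 / (|R| + 1) = ε / 4 / (|R| + 1) + ε / 4 / (|R| + 1) := by ring
      linarith
    rw [e1]
    calc _ ≤ _ := norm_add_le _ _
      _ ≤ ε / 2 / c₁ * c₁ + (|R| + 1) * (ε / 2 / (|R| + 1)) := by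
        refine add_le_add (e2.trans (by gcongr)) (e3.trans ?_)
        refine mul_le_mul (by linarith) e5 ?_ (by positivity)
        exact intervalIntegral.integral_nonneg hle fun s _ => norm_nonneg _
      _ = ε := by field_simp; ring
  rw [← tendstoLocallyUniformlyOn_iff_tendstoUniformlyOn_of_compact isCompact_Icc,
    Metric.tendstoLocallyUniformlyOn_iff]
  intro ε hε t ht
  obtain ⟨δ, hδ, hδh⟩ := hequi (ε / 2) (by positivity)
  refine ⟨Icc 0 T ∩ Metric.ball t δ, inter_mem_nhdsWithin _ (Metric.ball_mem_nhds _ hδ), ?_⟩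
  have hpt : Tendsto (fun i => h i t) l (𝓝 0) := by
    refine tendsto_integral_zero_of_weakly_null ht.1
      (hΦ.comp (continuous_const.prodMk continuous_id)) (fun s => hΦ0 (t, s)) hw
      (fun i => hL1 1 one_pos i 0 t le_rfl ht.1 ht.2) ?_
    exact fun v a ha b hb => hw0 v a ⟨ha.1, ha.2.trans ht.2⟩ b ⟨hb.1, hb.2.trans ht.2⟩
  filter_upwards [Metric.tendsto_nhds.1 hpt (ε / 2) (by positivity)] with i hi t' ht'
  rw [dist_zero_right] at hi
  rw [Pi.zero_apply, dist_zero_left]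
  have h1 := hδh i t ht t' ht'.1 (by rw [← Real.dist_eq]; exact ht'.2)
  have h2 : h i t' = (h i t' - h i t) + h i t := by abel
  change ‖h i t'‖ < ε
  rw [h2]
  exact (norm_add_le _ _).trans_lt (by linarith)

end Convolution

/-! ### Weak measurability in separable Hilbert spaces -/

section WeakMeasurability

variable {H : Type*} [NormedAddCommGroup H] [InnerProductSpace ℝ H]

/-- Orthonormal vectors are `√2` apart, so balls of radius `1 / 2` around them are disjoint open
sets. -/
lemma Orthonormal.countable_of_separableSpace [TopologicalSpace.SeparableSpace H] {ι : Type*}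
    {b : ι → H} (hb : Orthonormal ℝ b) : Countable ι := by
  rw [← Set.countable_univ_iff]
  refine Set.PairwiseDisjoint.countable_of_isOpen (s := fun i => Metric.ball (b i) (1 / 2)) ?_
    (fun i _ => Metric.isOpen_ball) (fun i _ => ⟨b i, Metric.mem_ball_self (by norm_num)⟩)
  intro i _ j _ hij
  refine Metric.ball_disjoint_ball ?_
  have h : dist (b i) (b j) ^ 2 = 2 := by
    rw [dist_eq_norm, norm_sub_sq_real, hb.1, hb.1, hb.2 hij]; norm_num
  nlinarith [dist_nonneg (x := b i) (y := b j)]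

/-- A weakly measurable function with values in a separable Hilbert space is measurable. -/
lemma stronglyMeasurable_of_forall_inner [CompleteSpace H] [TopologicalSpace.SeparableSpace H]
    {X : Type*} [MeasurableSpace X] {f : X → H}
    (hf : ∀ v, StronglyMeasurable fun x => inner ℝ (f x) v) : StronglyMeasurable f := by
  have : Countable (onbIndex H) := (onb H).orthonormal.countable_of_separableSpace
  refine stronglyMeasurable_of_tendsto (atTop : Filter (Finset (onbIndex H)))
    (f := fun F x => ∑ i ∈ F, (onb H).repr (f x) i • onb H i) (fun F => ?_)
    (tendsto_pi_nhds.2 fun x => (onb H).hasSum_repr (f x))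
  refine Finset.stronglyMeasurable_fun_sum _ fun i _ => ?_
  simp only [HilbertBasis.repr_apply_apply, real_inner_comm]
  exact (hf _).smul_const _

/-- The composition is weakly continuous, hence weakly measurable; separability of `H` upgrades this
to strong measurability. -/
lemma Demicontinuous.aestronglyMeasurable_comp [CompleteSpace H]
    [TopologicalSpace.SeparableSpace H] {f : H → H} (hf : Demicontinuous f) {y : ℝ → H}
    (hy : Continuous y) : AEStronglyMeasurable (fun s => f (y s)) volume := by
  refine (stronglyMeasurable_of_forall_inner fun v => ?_).aestronglyMeasurable
  refine Continuous.stronglyMeasurable (continuous_iff_seqContinuous.2 fun s s₀ hs => ?_)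
  exact hf _ _ ((hy.tendsto s₀).comp hs) v

end WeakMeasurability

/-! ### Bounds and uniqueness for mild solutions -/

section Uniqueness

variable {H : Type*} [NormedAddCommGroup H] [InnerProductSpace ℝ H] [CompleteSpace H]
  {S : ℝ → H →L[ℝ] H} {lam : ℝ} {G : ℝ → H → H} {k : ℝ → ℝ} {κ : ℝ → ℝ → ℝ}

/-- The stability estimate with `p = z`, `ε = 0`, `b = 1`. The local bound `κ R` of the particular
solution drops out, leaving a bound uniform over a family of controls. -/
lemma IsQuasiContractive.norm_sq_le_of_eq_mild (hS : IsQuasiContractive S lam)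
    (hG : IsOneSidedLipschitz G k κ) {x : H} {T : ℝ} {z : ℝ → H} (hz : Continuous z)
    (hzeq : ∀ t ∈ Icc 0 T, z t = mild S x (fun s => G s (z s)) t) {t : ℝ} (ht : t ∈ Icc 0 T) :
    ‖z t‖ ^ 2 ≤ Real.exp (2 * lam * T) * Real.exp (4 * ∫ s in (0 : ℝ)..T, (k s + κ 0 s)) *
      (‖x‖ ^ 2 + 2 * ∫ s in (0 : ℝ)..T, (k s + κ 0 s)) := by
  obtain ⟨R, hR⟩ := isCompact_Icc.exists_bound_of_continuousOn (hz.continuousOn (s := Icc 0 T))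
  have h := hS.norm_mild_sq_le (p := z) (hG.intervalIntegrable hz) x
    (fun a b => (hG.k_integrable a b).add (hG.κ_integrable 0 a b))
    (fun s => add_nonneg (hG.k_nonneg s) (hG.κ_zero_nonneg s)) (hG.κ_integrable R)
    le_rfl zero_le_one (fun s hs => by rw [← hzeq s hs]; simp)
    (fun s _ => hG.inner_self_le s (z s)) (fun s hs => hG.norm_le R s _ (hR s hs)) ht
  rw [← hzeq t ht] at h
  refine h.trans_eq ?_
  ring

lemma IsQuasiContractive.eq_of_eq_mild (hS : IsQuasiContractive S lam)
    (hG : IsOneSidedLipschitz G k κ) {x : H} {T : ℝ} {z z' : ℝ → H} (hz : Continuous z)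
    (hz' : Continuous z') (hzeq : ∀ t ∈ Icc 0 T, z t = mild S x (fun s => G s (z s)) t)
    (hzeq' : ∀ t ∈ Icc 0 T, z' t = mild S x (fun s => G s (z' s)) t) {t : ℝ} (ht : t ∈ Icc 0 T) :
    z t = z' t := by
  obtain ⟨R, hR⟩ := isCompact_Icc.exists_bound_of_continuousOn (hz.continuousOn (s := Icc 0 T))
  obtain ⟨R', hR'⟩ := isCompact_Icc.exists_bound_of_continuousOn (hz'.continuousOn (s := Icc 0 T))
  have hF := hG.intervalIntegrable hz
  have hF' := hG.intervalIntegrable hz'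
  have hsub : ∀ s ∈ Icc 0 T, z s - z' s = mild S 0 (fun s => G s (z s) - G s (z' s)) s := by
    intro s hs
    rw [hzeq s hs, hzeq' s hs, hS.mild_sub hF hF', sub_self]
  have h := hS.norm_mild_sq_le (p := fun s => z s - z' s)
    (fun a b => (hF a b).sub (hF' a b)) 0 hG.k_integrable hG.k_nonneg
    (fun a b => (hG.κ_integrable R a b).add (hG.κ_integrable R' a b)) (b := 0)
    le_rfl le_rfl (fun s hs => by rw [← hsub s hs]; simp)
    (fun s _ => by rw [add_zero]; exact hG.inner_le s _ _)
    (fun s hs => (norm_sub_le _ _).trans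
      (add_le_add (hG.norm_le R s _ (hR s hs)) (hG.norm_le R' s _ (hR' s hs)))) ht
  rw [← hsub t ht] at h
  simp only [norm_zero, ne_eq, OfNat.ofNat_ne_zero, not_false_eq_true, zero_pow, mul_zero,
    add_zero, zero_mul] at h
  have h0 : ‖z t - z' t‖ = 0 := by nlinarith [norm_nonneg (z t - z' t)]
  exact sub_eq_zero.1 (norm_eq_zero.1 h0)

end Uniqueness

/-! ### The controlled nonlinearity `f(x) + g(x) u(s)` -/

section Controlled

variable {U H : Type*} [NormedAddCommGroup U] [InnerProductSpace ℝ U] [CompleteSpace U]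
  [NormedAddCommGroup H] [InnerProductSpace ℝ H] [CompleteSpace H]

lemma norm_sub_le_of_hsNorm_le {g : H → U →L[ℝ] H} {D : ℝ≥0}
    (hg : ∀ x y : H, hsNorm (g x - g y) ≤ D * ‖x - y‖ₑ) (x y : H) :
    ‖g x - g y‖ ≤ D * ‖x - y‖ := by
  have h := (enorm_le_hsNorm _).trans (hg x y)
  have h' := ENNReal.toReal_mono (ENNReal.mul_ne_top ENNReal.coe_ne_top enorm_ne_top) h
  simpa [ENNReal.toReal_mul] using h'

omit [CompleteSpace U] [CompleteSpace H] [InnerProductSpace ℝ H] in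
lemma continuous_of_norm_sub_le {E : Type*} [SeminormedAddCommGroup E] {g : H → E} {D : ℝ≥0}
    (hg : ∀ x y : H, ‖g x - g y‖ ≤ D * ‖x - y‖) : Continuous g :=
  (LipschitzWith.of_dist_le_mul fun x y => by simpa [dist_eq_norm] using hg x y).continuous

variable {f : H → H} {C : ℝ} {m : ℕ} {M : ℝ} {g : H → U →L[ℝ] H} {D : ℝ≥0}

omit [CompleteSpace U] in
-- The control enters the one-sided constant through `D * ‖u s‖`, which is only integrable in time;
-- hence Gronwall with an integrable kernel.
lemma isOneSidedLipschitz_controlled [TopologicalSpace.SeparableSpace H]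
    (hf_demi : Demicontinuous f) (hf_growth : ∀ x : H, ‖f x‖ ≤ C * (1 + ‖x‖ ^ m)) (hM : 0 ≤ M)
    (hf_mono : ∀ x y : H, inner ℝ (f x - f y) (x - y) ≤ M * ‖x - y‖ ^ 2)
    (hg : ∀ x y : H, ‖g x - g y‖ ≤ D * ‖x - y‖) {u : ℝ → U} (hu : Integrable u) :
    IsOneSidedLipschitz (fun s x => f x + g x (u s)) (fun s => M + D * ‖u s‖)
      (fun R s => |C| * (1 + |R| ^ m) + (‖g 0‖ + D * |R|) * ‖u s‖) where
  aestronglyMeasurable y hy := by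
    refine (hf_demi.aestronglyMeasurable_comp hy).add ?_
    have hc : Continuous fun p : (U →L[ℝ] H) × U => p.1 p.2 := isBoundedBilinearMap_apply.continuous
    exact hc.comp_aestronglyMeasurable
      (((continuous_of_norm_sub_le hg).comp hy).aestronglyMeasurable.prodMk hu.1)
  k_integrable a b := intervalIntegrable_const.add (hu.norm.intervalIntegrable.const_mul _)
  k_nonneg s := by positivity
  κ_integrable R a b := intervalIntegrable_const.add (hu.norm.intervalIntegrable.const_mul _)
  norm_le R s x hx := by
    have hx' : ‖x‖ ≤ |R| := hx.trans (le_abs_self R)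
    refine (norm_add_le _ _).trans (add_le_add ((hf_growth x).trans ?_) ?_)
    · calc C * (1 + ‖x‖ ^ m) ≤ |C| * (1 + ‖x‖ ^ m) := by gcongr; exact le_abs_self C
        _ ≤ |C| * (1 + |R| ^ m) := by gcongr
    · refine ((g x).le_opNorm _).trans (mul_le_mul_of_nonneg_right ?_ (norm_nonneg _))
      have h1 := norm_add_le (g 0) (g x - g 0)
      rw [add_sub_cancel] at h1
      have h2 := hg x 0
      rw [sub_zero] at h2
      have h3 : D * ‖x‖ ≤ D * |R| := by gcongr
      linarith
  inner_le s x y := by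
    have h1 : f x + g x (u s) - (f y + g y (u s)) = (f x - f y) + (g x - g y) (u s) := by
      rw [sub_apply]; abel
    rw [h1, inner_add_left, add_mul]
    refine add_le_add (hf_mono x y) ((real_inner_le_norm _ _).trans ?_)
    calc ‖(g x - g y) (u s)‖ * ‖x - y‖ ≤ (D * ‖x - y‖ * ‖u s‖) * ‖x - y‖ := by
          gcongr
          exact ((g x - g y).le_opNorm _).trans (by gcongr; exact hg x y)
      _ = _ := by ring
  demicontinuous s x x₀ hx v := by
    simp only [inner_add_left]
    refine (hf_demi x x₀ hx v).add (Tendsto.inner ?_ tendsto_const_nhds)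
    have hc : Continuous fun y => g y (u s) :=
      (ContinuousLinearMap.apply ℝ H (u s)).continuous.comp (continuous_of_norm_sub_le hg)
    exact (hc.tendsto x₀).comp hx

/-- Weakly convergent bounded controls have uniformly convergent mild solutions. -/
theorem tendstoUniformlyOn_mild_controlled [TopologicalSpace.SeparableSpace H]
    {S : ℝ → H →L[ℝ] H} {lam : ℝ} (hS : IsQuasiContractive S lam)
    (hf_demi : Demicontinuous f) (hf_growth : ∀ x : H, ‖f x‖ ≤ C * (1 + ‖x‖ ^ m)) (hM : 0 ≤ M)
    (hf_mono : ∀ x y : H, inner ℝ (f x - f y) (x - y) ≤ M * ‖x - y‖ ^ 2)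
    (hg_hs : ∀ x : H, IsHilbertSchmidt (g x))
    (hg : ∀ x y : H, ‖g x - g y‖ ≤ D * ‖x - y‖)
    {X₀ : H} {T : ℝ} (hT : 0 < T) {ι : Type*} {l : Filter ι} {u : ι → ℝ → U} {u₀ : ℝ → U} {N : ℝ}
    (hu : ∀ i, Integrable (u i)) (hu₀ : Integrable u₀)
    (hu2 : ∀ i, MemLp (u i) 2) (hu₀2 : MemLp u₀ 2)
    (huN : ∀ i, ∫ s in (0 : ℝ)..T, ‖u i s‖ ^ 2 ≤ N) (hu₀N : ∫ s in (0 : ℝ)..T, ‖u₀ s‖ ^ 2 ≤ N)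
    (hweak : ∀ v : U, ∀ a ∈ Icc 0 T, ∀ b ∈ Icc 0 T,
      Tendsto (fun i => inner ℝ v (∫ s in a..b, (u i s - u₀ s))) l (𝓝 0))
    {z : ι → ℝ → H} {z₀ : ℝ → H} (hz : ∀ i, Continuous (z i)) (hz₀ : Continuous z₀)
    (hzeq : ∀ i, ∀ t ∈ Icc 0 T, z i t = mild S X₀ (fun s => f (z i s) + g (z i s) (u i s)) t)
    (hzeq₀ : ∀ t ∈ Icc 0 T, z₀ t = mild S X₀ (fun s => f (z₀ s) + g (z₀ s) (u₀ s)) t) :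
    TendstoUniformlyOn z z₀ l (Icc 0 T) := by
  have hsq : ∀ {v : ℝ → U}, MemLp v 2 → Integrable (fun s => ‖v s‖ ^ 2) := fun hv =>
    (memLp_two_iff_integrable_sq_norm hv.1).1 hv
  have hGi : ∀ {v : ℝ → U}, Integrable v → _ := fun hv =>
    isOneSidedLipschitz_controlled hf_demi hf_growth hM hf_mono hg hv
  -- All constants below are affine in `‖v s‖`; Young's inequality with `η = 1` gives `∫ ‖v‖ ≤ T +
  -- N`.
  have haff : ∀ {v : ℝ → U}, Integrable v → MemLp v 2 → ∫ s in (0 : ℝ)..T, ‖v s‖ ^ 2 ≤ N →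
      ∀ α β : ℝ, 0 ≤ β → ∫ s in (0 : ℝ)..T, (α + β * ‖v s‖) ≤ T * α + β * (T + N) := by
    intro v hv hv2 hvN α β hβ
    rw [intervalIntegral.integral_add intervalIntegrable_const
      (hv.norm.intervalIntegrable.const_mul _), intervalIntegral.integral_const,
      intervalIntegral.integral_const_mul, sub_zero, smul_eq_mul]
    have := integral_norm_le_of_integral_norm_sq_le hT.le one_pos hv.intervalIntegrable
      (hsq hv2).intervalIntegrable hvN
    rw [sub_zero, div_one, one_mul] at this
    gcongr
  -- a bound for all solutions
  set K' := T * (M + |C| * (1 + |(0 : ℝ)| ^ m)) + (D + (‖g 0‖ + D * |(0 : ℝ)|)) * (T + N)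
  set R := √(Real.exp (2 * lam * T) * Real.exp (4 * K') * (‖X₀‖ ^ 2 + 2 * K'))
  have hbound : ∀ {v : ℝ → U}, Integrable v → MemLp v 2 → ∫ s in (0 : ℝ)..T, ‖v s‖ ^ 2 ≤ N →
      ∀ {ζ : ℝ → H}, Continuous ζ →
      (∀ t ∈ Icc 0 T, ζ t = mild S X₀ (fun s => f (ζ s) + g (ζ s) (v s)) t) →
      ∀ t ∈ Icc 0 T, ‖ζ t‖ ≤ R := by
    intro v hv hv2 hvN ζ hζ hζeq t ht
    refine Real.le_sqrt_of_sq_le ((hS.norm_sq_le_of_eq_mild (hGi hv) hζ hζeq ht).trans ?_)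
    have h1 : ∫ s in (0 : ℝ)..T, ((M + D * ‖v s‖) +
        (|C| * (1 + |(0 : ℝ)| ^ m) + (‖g 0‖ + D * |(0 : ℝ)|) * ‖v s‖)) ≤ K' := by
      refine le_trans (le_of_eq ?_) (haff hv hv2 hvN _ _ (by positivity))
      refine intervalIntegral.integral_congr fun s _ => ?_
      ring
    have h0 : 0 ≤ ∫ s in (0 : ℝ)..T, ((M + D * ‖v s‖) +
        (|C| * (1 + |(0 : ℝ)| ^ m) + (‖g 0‖ + D * |(0 : ℝ)|) * ‖v s‖)) :=
      intervalIntegral.integral_nonneg hT.le fun s _ => by positivity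
    gcongr
  have hzR : ∀ i, ∀ t ∈ Icc 0 T, ‖z i t‖ ≤ R := fun i =>
    hbound (hu i) (hu2 i) (huN i) (hz i) (hzeq i)
  have hz₀R : ∀ t ∈ Icc 0 T, ‖z₀ t‖ ≤ R := hbound hu₀ hu₀2 hu₀N hz₀ hzeq₀
  -- the convolution with the weakly null sequence of controls
  set w : ι → ℝ → U := fun i s => u i s - u₀ s
  have hw : ∀ i, Integrable (w i) := fun i => (hu i).sub hu₀
  have hw2 : ∀ i, MemLp (w i) 2 := fun i => (hu2 i).sub hu₀2
  have hgz : Continuous fun s => g (z₀ s) := (continuous_of_norm_sub_le hg).comp hz₀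
  set Φ : ℝ × ℝ → U →L[ℝ] H := fun p => (S (p.1 - p.2)).comp (g (z₀ p.2))
  have hΦ : Continuous Φ := (hS.continuous_comp hgz
    fun s => (hg_hs (z₀ s)).mem_closure_finiteRankOperators).comp
      ((continuous_fst.sub continuous_snd).prodMk continuous_snd)
  have hconv : TendstoUniformlyOn (fun i t => ∫ s in (0 : ℝ)..t, Φ (t, s) (w i s)) 0 l
      (Icc 0 T) := by
    -- The constant `4 * N` comes from `‖u - u₀‖² ≤ 2‖u‖² + 2‖u₀‖²`.
    refine tendstoUniformlyOn_integral_zero_of_weakly_null (c := 4 * N) hT.le hΦ ?_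
      (fun i a b => (hw i).intervalIntegrable) (fun i a b => (hsq (hw2 i)).intervalIntegrable) ?_
      hweak
    · rintro p v ⟨c, hc⟩ hv
      have h1 := tendsto_zero_of_mem_closure_finiteRankOperators
        (hg_hs (z₀ p.2)).mem_closure_finiteRankOperators hc hv
      simpa [Φ, Function.comp_def] using ((S (p.1 - p.2)).continuous.tendsto 0).comp h1
    · intro i
      have h1 : ∫ s in (0 : ℝ)..T, ‖w i s‖ ^ 2 ≤
          ∫ s in (0 : ℝ)..T, (2 * ‖u i s‖ ^ 2 + 2 * ‖u₀ s‖ ^ 2) := by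
        refine intervalIntegral.integral_mono_on hT.le (hsq (hw2 i)).intervalIntegrable
          (((hsq (hu2 i)).intervalIntegrable.const_mul 2).add
            ((hsq hu₀2).intervalIntegrable.const_mul 2)) fun s _ => ?_
        have := norm_sub_le (u i s) (u₀ s)
        nlinarith [norm_nonneg (u i s - u₀ s), sq_nonneg (‖u i s‖ - ‖u₀ s‖)]
      rw [intervalIntegral.integral_add ((hsq (hu2 i)).intervalIntegrable.const_mul 2)
        ((hsq hu₀2).intervalIntegrable.const_mul 2), intervalIntegral.integral_const_mul,
        intervalIntegral.integral_const_mul] at h1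
      linarith [huN i]
  -- the stability estimate
  set K := T * M + D * (T + N)
  set J := T * (2 * (|C| * (1 + |R| ^ m))) + 2 * (‖g 0‖ + D * |R|) * (T + N)
  set W := Real.exp (2 * lam * T) * Real.exp (4 * K)
  have hmain : ∀ η : ℝ, 0 < η → ∀ i, (∀ t ∈ Icc 0 T, ‖∫ s in (0 : ℝ)..t, Φ (t, s) (w i s)‖ ≤ η) →
      ∀ t ∈ Icc 0 T, ‖z i t - z₀ t‖ ≤ √(W * (4 * η ^ 2 * K + 2 * η * J)) + η := by
    intro η hη i hη' t ht
    have hG := hGi (hu i)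
    have hF := hG.intervalIntegrable (hz i)
    have hF' := hG.intervalIntegrable hz₀
    have hFw : ∀ a b, IntervalIntegrable (fun s => g (z₀ s) (w i s)) volume a b := fun a b =>
      intervalIntegrable_clm_apply hgz (hw i).intervalIntegrable
    -- Insert `g (z₀ s) (u i s)`: both nonlinearities then carry the control `u i` and the one-sided
    -- bound applies, while the mismatch of controls is the convolution, already known to be small.
    have ha : ∀ s ∈ Icc 0 T, mild S 0 (fun s => (f (z i s) + g (z i s) (u i s)) -
        (f (z₀ s) + g (z₀ s) (u i s))) s =
        z i s - z₀ s - ∫ r in (0 : ℝ)..s, Φ (s, r) (w i r) := by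
      intro s hs
      rw [← sub_self X₀, ← hS.mild_sub hF hF', ← hzeq i s hs]
      have h1 : mild S X₀ (fun s => f (z₀ s) + g (z₀ s) (u i s)) s - z₀ s =
          ∫ r in (0 : ℝ)..s, Φ (s, r) (w i r) := by
        rw [hzeq₀ s hs, hS.mild_sub hF' ((hGi hu₀).intervalIntegrable hz₀), sub_self]
        simp only [mild, map_zero, zero_add]
        refine intervalIntegral.integral_congr fun r _ => ?_
        simp only [Φ, w, ContinuousLinearMap.comp_apply, map_sub]
        rw [← map_sub, add_sub_add_left_eq_sub, map_sub]
      rw [← h1]; abel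
    have h := hS.norm_mild_sq_le (p := fun s => z i s - z₀ s)
      (fun a b => (hF a b).sub (hF' a b)) 0 hG.k_integrable hG.k_nonneg
      (fun a b => (hG.κ_integrable R a b).const_mul 2) (b := 0) hη.le le_rfl
      (fun s hs => by rw [ha s hs, sub_sub_cancel]; exact hη' s hs)
      (fun s _ => by rw [add_zero]; exact hG.inner_le s _ _)
      (fun s hs => (norm_sub_le _ _).trans (by
        have e1 := hG.norm_le R s _ (hzR i s hs)
        have e2 := hG.norm_le R s _ (hz₀R s hs)
        linarith)) ht
    rw [ha t ht] at h
    have hK : ∫ s in (0 : ℝ)..T, (M + D * ‖u i s‖) ≤ K :=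
      haff (hu i) (hu2 i) (huN i) _ _ D.2
    have hJ : ∫ s in (0 : ℝ)..T, 2 * (|C| * (1 + |R| ^ m) + (‖g 0‖ + D * |R|) * ‖u i s‖) ≤ J := by
      refine le_trans (le_of_eq ?_) (haff (hu i) (hu2 i) (huN i) _ _ (by positivity))
      refine intervalIntegral.integral_congr fun s _ => ?_
      ring
    have hK0 : 0 ≤ ∫ s in (0 : ℝ)..T, (M + D * ‖u i s‖) :=
      intervalIntegral.integral_nonneg hT.le fun s _ => by positivity
    have hJ0 : 0 ≤ ∫ s in (0 : ℝ)..T,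
        2 * (|C| * (1 + |R| ^ m) + (‖g 0‖ + D * |R|) * ‖u i s‖) :=
      intervalIntegral.integral_nonneg hT.le fun s _ => by positivity
    have h2 : ‖z i t - z₀ t - ∫ r in (0 : ℝ)..t, Φ (t, r) (w i r)‖ ≤
        √(W * (4 * η ^ 2 * K + 2 * η * J)) := by
      refine Real.le_sqrt_of_sq_le (h.trans ?_)
      rw [norm_zero, zero_pow two_ne_zero, zero_add, mul_zero, add_zero]
      simp only [W]
      gcongr
    have h3 := norm_add_le (z i t - z₀ t - ∫ r in (0 : ℝ)..t, Φ (t, r) (w i r))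
      (∫ r in (0 : ℝ)..t, Φ (t, r) (w i r))
    rw [sub_add_cancel] at h3
    linarith [hη' t ht]
  rw [Metric.tendstoUniformlyOn_iff]
  intro ε hε
  have hlim : Tendsto (fun η : ℝ => √(W * (4 * η ^ 2 * K + 2 * η * J)) + η) (𝓝[>] 0) (𝓝 0) := by
    have hc : Continuous fun η : ℝ => √(W * (4 * η ^ 2 * K + 2 * η * J)) + η := by fun_prop
    simpa using (hc.tendsto 0).mono_left nhdsWithin_le_nhds
  obtain ⟨η, hη, hη0⟩ :=
    (((tendsto_order.1 hlim).2 ε hε).and self_mem_nhdsWithin).exists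
  filter_upwards [Metric.tendstoUniformlyOn_iff.1 hconv η hη0] with i hi t ht
  rw [dist_comm, dist_eq_norm]
  refine (hmain η hη0 i (fun s hs => ?_) t ht).trans_lt hη
  have := hi s hs
  rw [Pi.zero_apply, dist_zero_left] at this
  exact this.le

end Controlled

/-! ### Controls extended by zero -/

section Controls

variable {U : Type*} [NormedAddCommGroup U] {T : ℝ}

/-- A control, extended by zero to the real line. -/
noncomputable def controlExt (u : ControlSpace T U) : ℝ → U := (Icc (0 : ℝ) T).indicator u

lemma controlExt_of_mem (u : ControlSpace T U) {s : ℝ} (hs : s ∈ Icc 0 T) :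
    controlExt u s = u s := indicator_of_mem hs _

lemma memLp_controlExt (u : ControlSpace T U) : MemLp (controlExt u) 2 :=
  (memLp_indicator_iff_restrict measurableSet_Icc).2 (Lp.memLp u)

lemma integrable_controlExt (u : ControlSpace T U) : Integrable (controlExt u) :=
  (integrable_indicator_iff measurableSet_Icc).2 ((Lp.memLp u).integrable (by norm_num))

lemma integral_norm_controlExt_sq (hT : 0 ≤ T) (u : ControlSpace T U) :
    ∫ s in (0 : ℝ)..T, ‖controlExt u s‖ ^ 2 = ∫ s in (0 : ℝ)..T, ‖u s‖ ^ 2 :=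
  intervalIntegral.integral_congr fun s hs => by
    simp only [controlExt_of_mem u (uIcc_of_le hT ▸ hs)]

variable [InnerProductSpace ℝ U]

lemma norm_sq_eq_integral (hT : 0 ≤ T) (u : ControlSpace T U) :
    ‖u‖ ^ 2 = ∫ s in (0 : ℝ)..T, ‖u s‖ ^ 2 := by
  rw [← real_inner_self_eq_norm_sq, L2.inner_def, intervalIntegral.integral_of_le hT,
    integral_Icc_eq_integral_Ioc]
  simp only [real_inner_self_eq_norm_sq]

lemma mem_controlBall_iff (hT : 0 ≤ T) {N : ℝ} (hN : 0 ≤ N) (u : ControlSpace T U) :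
    u ∈ controlBall T U N ↔ ‖u‖ ≤ √N := by
  rw [Real.le_sqrt (norm_nonneg _) hN, norm_sq_eq_integral hT]
  rfl

variable [CompleteSpace U]

/-- Lebesgue differentiation recovers the control from its primitive; so a map defined on primitives
may be regarded as a map of controls. -/
lemma controlPrimitive_injective :
    Function.Injective (controlPrimitive : ControlSpace T U → C(Icc (0 : ℝ) T, U)) := by
  intro u v huv
  have hprim : ∀ t ∈ Icc 0 T,
      ∫ s in (0 : ℝ)..t, controlExt u s = ∫ s in (0 : ℝ)..t, controlExt v s := by
    intro t ht
    have h : ∀ w : ControlSpace T U,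
        ∫ s in (0 : ℝ)..t, controlExt w s = controlPrimitive w ⟨t, ht⟩ := fun w =>
      intervalIntegral.integral_congr fun s hs => by
        rw [uIcc_of_le ht.1] at hs
        exact controlExt_of_mem w ⟨hs.1, hs.2.trans ht.2⟩
    rw [h, h, huv]
  suffices h : ∀ᵐ x ∂volume.restrict (Ioo 0 T), u x = v x by
    rw [restrict_Ioo_eq_restrict_Icc] at h
    exact Lp.ext h
  filter_upwards [ae_restrict_mem measurableSet_Ioo,
    ae_restrict_of_ae
      (LocallyIntegrable.ae_hasDerivAt_integral (integrable_controlExt u).locallyIntegrable),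
    ae_restrict_of_ae
      (LocallyIntegrable.ae_hasDerivAt_integral (integrable_controlExt v).locallyIntegrable)]
    with x hx h1 h2
  rw [← controlExt_of_mem u (Ioo_subset_Icc_self hx), ← controlExt_of_mem v
    (Ioo_subset_Icc_self hx)]
  refine (h1 0).unique ((h2 0).congr_of_eventuallyEq ?_)
  filter_upwards [Ioo_mem_nhds hx.1 hx.2] with t ht
  exact hprim t (Ioo_subset_Icc_self ht)

/-- Pairing `∫₀ᵗ u` with `v` is pairing `u` in `L²` with the step function equal to `v` on `(0, t]`.
-/
lemma tendsto_inner_integral_controlExt {ι : Type*} {l : Filter ι} {u : ι → ControlSpace T U}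
    {u₀ : ControlSpace T U} (h : ∀ v, Tendsto (fun i => inner ℝ (u i) v) l (𝓝 (inner ℝ u₀ v)))
    (v : U) {a b : ℝ} (ha : a ∈ Icc 0 T) (hb : b ∈ Icc 0 T) :
    Tendsto (fun i => inner ℝ v (∫ s in a..b, (controlExt (u i) s - controlExt u₀ s))) l
      (𝓝 0) := by
  have key : ∀ t ∈ Icc 0 T, Tendsto (fun i => inner ℝ v (∫ s in (0 : ℝ)..t, controlExt (u i) s)) l
      (𝓝 (inner ℝ v (∫ s in (0 : ℝ)..t, controlExt u₀ s))) := by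
    intro t ht
    have hrep : ∀ w : ControlSpace T U, inner ℝ v (∫ s in (0 : ℝ)..t, controlExt w s) =
        inner ℝ w (indicatorConstLp 2 (measurableSet_Ioc (a := (0 : ℝ)) (b := t))
          (measure_ne_top (volume.restrict (Icc (0 : ℝ) T)) _) v) := by
      intro w
      refine Eq.trans ?_ (real_inner_comm _ _)
      rw [L2.inner_indicatorConstLp_eq_inner_setIntegral,
        Measure.restrict_restrict measurableSet_Ioc, inter_eq_left.2
          (Ioc_subset_Icc_self.trans (Icc_subset_Icc_right ht.2)),
        intervalIntegral.integral_of_le ht.1]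
      congr 1
      refine setIntegral_congr_fun measurableSet_Ioc fun s hs => ?_
      exact controlExt_of_mem w ⟨hs.1.le, hs.2.trans ht.2⟩
    simp only [hrep]
    exact h _
  have hI : ∀ w : ControlSpace T U, ∀ a b, IntervalIntegrable (controlExt w) volume a b :=
    fun w a b => (integrable_controlExt w).intervalIntegrable
  have h0 : ∀ i, inner ℝ v (∫ s in a..b, (controlExt (u i) s - controlExt u₀ s)) =
      (inner ℝ v (∫ s in (0 : ℝ)..b, controlExt (u i) s) -
        inner ℝ v (∫ s in (0 : ℝ)..b, controlExt u₀ s)) -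
      (inner ℝ v (∫ s in (0 : ℝ)..a, controlExt (u i) s) -
        inner ℝ v (∫ s in (0 : ℝ)..a, controlExt u₀ s)) := by
    intro i
    rw [intervalIntegral.integral_sub (hI _ _ _) (hI _ _ _),
      ← intervalIntegral.integral_interval_sub_left (hI (u i) 0 b) (hI (u i) 0 a),
      ← intervalIntegral.integral_interval_sub_left (hI u₀ 0 b) (hI u₀ 0 a)]
    simp only [inner_sub_right]
    ring
  simp only [h0]
  simpa using ((key b hb).sub_const (inner ℝ v (∫ s in (0 : ℝ)..b, controlExt u₀ s))).sub
    ((key a ha).sub_const (inner ℝ v (∫ s in (0 : ℝ)..a, controlExt u₀ s)))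

end Controls

/-! ### The skeleton equation -/

section SkeletonEquation

variable {U H : Type*} [NormedAddCommGroup U] [InnerProductSpace ℝ U]
  [NormedAddCommGroup H] [InnerProductSpace ℝ H] {T : ℝ}

/-- For `0 ≤ s ≤ t ≤ T` neither the freezing of `S` nor the extension of the control by zero is
visible, and the integrability clause follows from the local bounds on the nonlinearity. -/
lemma isSkeletonSolution_iff (hT : 0 ≤ T) {S : ℝ → H →L[ℝ] H} {lam : ℝ}
    (hS : IsQuasiContractive (fun t => S (max t 0)) lam) {f : H → H} {g : H → U →L[ℝ] H}
    {k : ℝ → ℝ} {κ : ℝ → ℝ → ℝ} {X₀ : H} {u : ControlSpace T U} {z : C(Icc (0 : ℝ) T, H)}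
    (hG : IsOneSidedLipschitz (fun s x => f x + g x (controlExt u s)) k κ) :
    IsSkeletonSolution hT S f g X₀ u z ↔ ∀ t ∈ Icc 0 T, IccExtend hT z t =
      mild (fun t => S (max t 0)) X₀
        (fun s => f (IccExtend hT z s) + g (IccExtend hT z s) (controlExt u s)) t := by
  have hz : Continuous (IccExtend hT z) := z.continuous.Icc_extend'
  have heq : ∀ t ∈ Icc 0 T, ∀ s ∈ Icc 0 t,
      S (max (t - s) 0) (f (IccExtend hT z s) + g (IccExtend hT z s) (controlExt u s)) =
      S (t - s) (f (IccExtend hT z s) + g (IccExtend hT z s) (u s)) := by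
    intro t ht s hs
    rw [max_eq_left (sub_nonneg.2 hs.2), controlExt_of_mem u ⟨hs.1, hs.2.trans ht.2⟩]
  have hmild : ∀ t ∈ Icc 0 T, mild (fun t => S (max t 0)) X₀
        (fun s => f (IccExtend hT z s) + g (IccExtend hT z s) (controlExt u s)) t = S t X₀ +
      ∫ s in (0 : ℝ)..t, S (t - s) (f (IccExtend hT z s) + g (IccExtend hT z s) (u s)) := by
    intro t ht
    simp only [mild, max_eq_left ht.1]
    congr 1
    refine intervalIntegral.integral_congr fun s hs => ?_
    rw [uIcc_of_le ht.1] at hs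
    exact heq t ht s hs
  constructor
  · intro h t ht
    rw [hmild t ht, IccExtend_of_mem _ _ ht]
    exact (h ⟨t, ht⟩).2
  · rintro h ⟨t, ht⟩
    refine ⟨?_, ?_⟩
    · refine (hS.intervalIntegrable_sub (hG.intervalIntegrable hz) t 0 t).congr ?_
      intro s hs
      rw [uIoc_of_le ht.1] at hs
      exact heq t ht s (Ioc_subset_Icc_self hs)
    · rw [← hmild t ht, ← h t ht, IccExtend_of_mem _ _ ht]

variable [CompleteSpace U] [CompleteSpace H] [TopologicalSpace.SeparableSpace H]
  {S : ℝ → H →L[ℝ] H} {lam : ℝ} {f : H → H} {C : ℝ} {m : ℕ} {M : ℝ} {g : H → U →L[ℝ] H} {D : ℝ≥0}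

theorem skeletonMap_spec (hT : 0 < T) (hS : IsQuasiContractive (fun t => S (max t 0)) lam)
    (hf_demi : Demicontinuous f) (hf_growth : ∀ x : H, ‖f x‖ ≤ C * (1 + ‖x‖ ^ m)) (hM : 0 ≤ M)
    (hf_mono : ∀ x y : H, inner ℝ (f x - f y) (x - y) ≤ M * ‖x - y‖ ^ 2)
    (hg : ∀ x y : H, ‖g x - g y‖ ≤ D * ‖x - y‖) (X₀ : H) (u : ControlSpace T U) :
    IsSkeletonSolution hT.le S f g X₀ u (skeletonMap hT.le S f g X₀ (controlPrimitive u)) ∧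
      ∀ z : C(Icc (0 : ℝ) T, H), IsSkeletonSolution hT.le S f g X₀ u z →
        z = skeletonMap hT.le S f g X₀ (controlPrimitive u) := by
  have hG := isOneSidedLipschitz_controlled hf_demi hf_growth hM hf_mono hg
    (integrable_controlExt u)
  have hex : ∃ z : C(Icc (0 : ℝ) T, H), ∃ v : ControlSpace T U,
      controlPrimitive v = controlPrimitive u ∧ IsSkeletonSolution hT.le S f g X₀ v z := by
    obtain ⟨z, hz, hzeq⟩ := hS.exists_mild_solution hG X₀ hT
    refine ⟨⟨fun t => z t, hz.comp continuous_subtype_val⟩, u, rfl, ?_⟩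
    rw [isSkeletonSolution_iff hT.le hS hG]
    have hext : ∀ s ∈ Icc 0 T, IccExtend hT.le
        (⟨fun t => z t, hz.comp continuous_subtype_val⟩ : C(Icc (0 : ℝ) T, H)) s = z s :=
      fun s hs => IccExtend_of_mem _ _ hs
    intro t ht
    rw [hext t ht, hzeq t ht]
    refine mild_congr ht.1 fun s hs => ?_
    rw [hext s ⟨hs.1, hs.2.trans ht.2⟩]
  have hsol : IsSkeletonSolution hT.le S f g X₀ u
      (skeletonMap hT.le S f g X₀ (controlPrimitive u)) := by
    rw [skeletonMap, dif_pos hex]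
    -- The chosen path solves the equation for some control with the same primitive, which must be
    -- `u`.
    obtain ⟨v, hv, hvz⟩ := hex.choose_spec
    rwa [controlPrimitive_injective hv] at hvz
  refine ⟨hsol, fun z hz => ?_⟩
  rw [isSkeletonSolution_iff hT.le hS hG] at hsol hz
  ext t
  have h := hS.eq_of_eq_mild hG (z.continuous.Icc_extend')
    (ContinuousMap.continuous _).Icc_extend' hz hsol t.2
  rwa [IccExtend_of_mem _ _ t.2, IccExtend_of_mem _ _ t.2] at h

/-- An arbitrary filter is allowed, so this is weak-to-uniform continuity on `𝒮_N` and not only its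
sequential version. -/
theorem tendsto_skeletonMap (hT : 0 < T) (hS : IsQuasiContractive (fun t => S (max t 0)) lam)
    (hf_demi : Demicontinuous f) (hf_growth : ∀ x : H, ‖f x‖ ≤ C * (1 + ‖x‖ ^ m)) (hM : 0 ≤ M)
    (hf_mono : ∀ x y : H, inner ℝ (f x - f y) (x - y) ≤ M * ‖x - y‖ ^ 2)
    (hg_hs : ∀ x : H, IsHilbertSchmidt (g x))
    (hg : ∀ x y : H, ‖g x - g y‖ ≤ D * ‖x - y‖) (X₀ : H) {N : ℝ}
    {ι : Type*} {l : Filter ι} {u : ι → ControlSpace T U} {u₀ : ControlSpace T U}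
    (hu : ∀ i, u i ∈ controlBall T U N) (hu₀ : u₀ ∈ controlBall T U N)
    (h : ∀ v, Tendsto (fun i => inner ℝ (u i) v) l (𝓝 (inner ℝ u₀ v))) :
    Tendsto (fun i => skeletonMap hT.le S f g X₀ (controlPrimitive (u i))) l
      (𝓝 (skeletonMap hT.le S f g X₀ (controlPrimitive u₀))) := by
  have hsol : ∀ v : ControlSpace T U, _ := fun v =>
    (isSkeletonSolution_iff hT.le hS (isOneSidedLipschitz_controlled hf_demi hf_growth hM hf_mono hg
      (integrable_controlExt v))).1
      (skeletonMap_spec hT hS hf_demi hf_growth hM hf_mono hg X₀ v).1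
  have hunif := tendstoUniformlyOn_mild_controlled hS hf_demi hf_growth hM hf_mono hg_hs hg hT
    (N := N) (fun i => integrable_controlExt (u i)) (integrable_controlExt u₀)
    (fun i => memLp_controlExt (u i)) (memLp_controlExt u₀)
    (fun i => (integral_norm_controlExt_sq hT.le (u i)).trans_le (hu i))
    ((integral_norm_controlExt_sq hT.le u₀).trans_le hu₀)
    (fun v a ha b hb => tendsto_inner_integral_controlExt h v ha hb)
    (fun i => (ContinuousMap.continuous _).Icc_extend') (ContinuousMap.continuous _).Icc_extend'
    (fun i => hsol (u i)) (hsol u₀)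
  rw [ContinuousMap.tendsto_iff_tendstoUniformly, Metric.tendstoUniformly_iff]
  intro ε hε
  filter_upwards [Metric.tendstoUniformlyOn_iff.1 hunif ε hε] with i hi t
  have := hi t t.2
  rwa [IccExtend_of_mem _ _ t.2, IccExtend_of_mem _ _ t.2] at this

theorem isCompact_skeletonSet (hT : 0 < T) (hS : IsQuasiContractive (fun t => S (max t 0)) lam)
    (hf_demi : Demicontinuous f) (hf_growth : ∀ x : H, ‖f x‖ ≤ C * (1 + ‖x‖ ^ m)) (hM : 0 ≤ M)
    (hf_mono : ∀ x y : H, inner ℝ (f x - f y) (x - y) ≤ M * ‖x - y‖ ^ 2)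
    (hg_hs : ∀ x : H, IsHilbertSchmidt (g x))
    (hg : ∀ x y : H, ‖g x - g y‖ ≤ D * ‖x - y‖) (X₀ : H) (N : ℝ) :
    IsCompact (skeletonSet hT.le S f g X₀ N) := by
  rcases lt_or_ge N 0 with hN | hN
  · convert! isCompact_empty
    rw [eq_empty_iff_forall_notMem]
    rintro z ⟨u, hu, -⟩
    have h1 : ∫ s in (0 : ℝ)..T, ‖u s‖ ^ 2 ≤ N := hu
    rw [← norm_sq_eq_integral hT.le] at h1
    linarith [sq_nonneg ‖u‖]
  -- By Riesz, `𝒮_N` is a closed ball of the dual, weak-* compact by Banach–Alaoglu; no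
  -- metrizability, hence no separability of `U`, is needed.
  set B : Set (WeakDual ℝ (ControlSpace T U)) :=
    WeakDual.toStrongDual ⁻¹' Metric.closedBall 0 √N
  set r : WeakDual ℝ (ControlSpace T U) → ControlSpace T U := fun φ =>
    (InnerProductSpace.toDual ℝ (ControlSpace T U)).symm (WeakDual.toStrongDual φ)
  have hr : ∀ φ v, inner ℝ (r φ) v = φ v := fun φ v => InnerProductSpace.toDual_symm_apply
  have hrB : ∀ φ, φ ∈ B ↔ r φ ∈ controlBall T U N := fun φ => by
    rw [mem_controlBall_iff hT.le hN, LinearIsometryEquiv.norm_map]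
    exact iff_of_eq (congrArg (· ≤ √N)
      (dist_zero_right (WeakDual.toStrongDual φ : StrongDual ℝ (ControlSpace T U))))
  have himage : skeletonSet hT.le S f g X₀ N =
      (fun φ => skeletonMap hT.le S f g X₀ (controlPrimitive (r φ))) '' B := by
    ext z
    constructor
    · rintro ⟨u, hu, rfl⟩
      have hru : r (WeakDual.toStrongDual.symm
          (InnerProductSpace.toDual ℝ (ControlSpace T U) u)) = u := by simp [r]
      exact ⟨_, (hrB _).2 (by rwa [hru]), by simp only [hru]⟩
    · rintro ⟨φ, hφ, rfl⟩
      exact ⟨r φ, (hrB φ).1 hφ, rfl⟩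
  rw [himage]
  refine (WeakDual.isCompact_closedBall 0 √N).image_of_continuousOn ?_
  rw [continuousOn_iff_continuous_domRestrict, continuous_iff_continuousAt]
  intro φ₀
  refine tendsto_skeletonMap hT hS hf_demi hf_growth hM hf_mono hg_hs hg X₀
    (u := fun φ : B => r φ) (fun φ => (hrB φ).1 φ.2) ((hrB φ₀).1 φ₀.2) fun v => ?_
  simp only [hr]
  exact ((WeakDual.eval_continuous v).comp continuous_subtype_val).tendsto φ₀

end SkeletonEquation

/-! ### The rate function -/

section RateFunction

variable {U H : Type*} [NormedAddCommGroup U] [InnerProductSpace ℝ U]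
  [NormedAddCommGroup H] [InnerProductSpace ℝ H] {T : ℝ}
  {S : ℝ → H →L[ℝ] H} {f : H → H} {g : H → U →L[ℝ] H} {X₀ : H}

/-- The slack `1 / (n + 1)` avoids proving that the infimum is attained; the factor 2 undoes the `1
/ 2` in the energy. -/
lemma setOf_rateFunction_le (hT : 0 ≤ T) (N : ℝ≥0) :
    {φ | rateFunction hT S f g X₀ φ ≤ N} =
      ⋂ n : ℕ, skeletonSet hT S f g X₀ (2 * (N + 1 / (n + 1))) := by
  have hN : ∀ n : ℕ, ENNReal.ofReal (N + 1 / (n + 1)) = N + ENNReal.ofReal (1 / (n + 1)) := by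
    intro n
    rw [ENNReal.ofReal_add N.coe_nonneg (by positivity), ENNReal.ofReal_coe_nnreal]
  ext φ
  simp only [mem_iInter]
  constructor
  · intro hφ n
    have hlt : rateFunction hT S f g X₀ φ < ENNReal.ofReal (N + 1 / (n + 1)) := by
      refine lt_of_le_of_lt hφ ?_
      rw [hN]
      exact ENNReal.lt_add_right ENNReal.coe_ne_top (by
        rw [ne_eq, ENNReal.ofReal_eq_zero, not_le]; positivity)
    simp only [rateFunction, iInf_lt_iff] at hlt
    obtain ⟨u, hu, hlt⟩ := hlt
    refine ⟨u, ?_, hu⟩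
    have h1 := (ENNReal.ofReal_lt_ofReal_iff (by positivity)).1 hlt
    change ∫ s in (0 : ℝ)..T, ‖u s‖ ^ 2 ≤ _
    linarith
  · intro hφ
    have hle : ∀ n : ℕ, rateFunction hT S f g X₀ φ ≤ N + ENNReal.ofReal (1 / (n + 1)) := by
      intro n
      obtain ⟨u, hu, hφu⟩ := hφ n
      refine (iInf₂_le u hφu).trans ?_
      rw [← hN]
      have h1 : ∫ s in (0 : ℝ)..T, ‖u s‖ ^ 2 ≤ 2 * (N + 1 / (n + 1)) := hu
      exact ENNReal.ofReal_le_ofReal (by linarith)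
    have hlim : Tendsto (fun n : ℕ => (N : ℝ≥0∞) + ENNReal.ofReal (1 / (n + 1))) atTop
        (𝓝 (N + ENNReal.ofReal 0)) :=
      tendsto_const_nhds.add (ENNReal.tendsto_ofReal tendsto_one_div_add_atTop_nhds_zero_nat)
    rw [ENNReal.ofReal_zero, add_zero] at hlim
    exact ge_of_tendsto' hlim hle

/-- An intersection of compact, hence closed, sets lying inside the one with `n = 0`. -/
lemma isCompact_setOf_rateFunction_le (hT : 0 ≤ T)
    (h : ∀ N : ℝ, IsCompact (skeletonSet hT S f g X₀ N)) (N : ℝ≥0) :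
    IsCompact {φ | rateFunction hT S f g X₀ φ ≤ N} := by
  rw [setOf_rateFunction_le]
  exact (h _).of_isClosed_subset (isClosed_iInter fun n => (h _).isClosed) (iInter_subset _ 0)

lemma lowerSemicontinuous_rateFunction (hT : 0 ≤ T)
    (h : ∀ N : ℝ, IsCompact (skeletonSet hT S f g X₀ N)) :
    LowerSemicontinuous (rateFunction hT S f g X₀) := by
  rw [lowerSemicontinuous_iff_isClosed_preimage]
  intro y
  induction y with
  | top => simp
  | coe N => exact (isCompact_setOf_rateFunction_le hT h N).isClosed

end RateFunction

theorem theorem4p1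
    {U H : Type*}
    [NormedAddCommGroup U] [InnerProductSpace ℝ U] [CompleteSpace U]
    [NormedAddCommGroup H] [InnerProductSpace ℝ H] [CompleteSpace H]
    [TopologicalSpace.SeparableSpace H]
    {T : ℝ} (hT : 0 < T)
    -- `A` is closed, densely defined, and generates the semigroup `S`, with exponential bound
    (A : H →ₗ.[ℝ] H) (hA_closed : A.IsClosed) (hA_dense : Dense (A.domain : Set H))
    (S : ℝ → H →L[ℝ] H) (hS : IsC0Semigroup S) (hAS : IsGeneratorOf A S)
    (lam : ℝ) (hlam : 0 < lam) (hS_bound : ∀ t : ℝ, 0 ≤ t → ‖S t‖ ≤ Real.exp (lam * t))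
    -- `f` is demicontinuous, of polynomial growth, and `-f` is semimonotone
    (f : H → H) (hf_demi : Demicontinuous f)
    (C : ℝ) (m : ℕ) (hf_growth : ∀ x : H, ‖f x‖ ≤ C * (1 + ‖x‖ ^ m))
    (M : ℝ) (hM : 0 ≤ M)
    (hf_mono : ∀ x y : H, inner ℝ (f x - f y) (x - y) ≤ M * ‖x - y‖ ^ 2)
    -- `g` has Hilbert-Schmidt values and is Lipschitz in the Hilbert-Schmidt norm
    (g : H → U →L[ℝ] H) (hg_hs : ∀ x : H, IsHilbertSchmidt (g x))
    (D : ℝ≥0) (hg_lip : ∀ x y : H, hsNorm (g x - g y) ≤ D * ‖x - y‖ₑ)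
    (X₀ : H) :
    -- `𝒢⁰(∫₀ u ds)` is the unique solution of the skeleton equation with control `u`
    (∀ u : ControlSpace T U,
      IsSkeletonSolution hT.le S f g X₀ u (skeletonMap hT.le S f g X₀ (controlPrimitive u)) ∧
      ∀ z : C(Icc (0 : ℝ) T, H), IsSkeletonSolution hT.le S f g X₀ u z →
        z = skeletonMap hT.le S f g X₀ (controlPrimitive u)) ∧
    -- `K_N` is compact for every `N`
    (∀ N : ℝ, IsCompact (skeletonSet hT.le S f g X₀ N)) ∧
    -- the rate function is good
    (LowerSemicontinuous (rateFunction hT.le S f g X₀) ∧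
      ∀ N : ℝ≥0, IsCompact {φ | rateFunction hT.le S f g X₀ φ ≤ N}) ∧
    -- weak convergence of controls in `𝒮_N` gives uniform convergence of the solutions
    (∀ (N : ℝ) (u : ℕ → ControlSpace T U) (u₀ : ControlSpace T U),
      (∀ n, u n ∈ controlBall T U N) → u₀ ∈ controlBall T U N →
      (∀ v : ControlSpace T U, Tendsto (fun n => inner ℝ (u n) v) atTop (𝓝 (inner ℝ u₀ v))) →
      Tendsto (fun n => skeletonMap hT.le S f g X₀ (controlPrimitive (u n))) atTop
        (𝓝 (skeletonMap hT.le S f g X₀ (controlPrimitive u₀)))) := by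
  have hQ := hS.isQuasiContractive hlam.le hS_bound
  have hg := norm_sub_le_of_hsNorm_le hg_lip
  have hK := isCompact_skeletonSet hT hQ hf_demi hf_growth hM hf_mono hg_hs hg X₀
  exact ⟨skeletonMap_spec hT hQ hf_demi hf_growth hM hf_mono hg X₀, hK,
    ⟨lowerSemicontinuous_rateFunction hT.le hK, isCompact_setOf_rateFunction_le hT.le hK⟩,
    fun N u u₀ hu hu₀ h => tendsto_skeletonMap hT hQ hf_demi hf_growth hM hf_mono hg_hs hg X₀
      hu hu₀ h⟩
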